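/- Let $\Gamma$ be a generic shortest-path triangulation of the unit sphere $S^2$ with $n\ge 4$ vertices. That is, $\Gamma$ is an embedding of a simple graph in which every edge is a great-circular arc of length less than $\pi$, every face is bounded by a cycle of three edges (so the graph is maximal planar), no great circle contains more than two vertices, and no great circle through the poles $(0,0,\pm1)$ contains more than one vertex. Represent each vertex $i$ by any coordinate vector $(x_i,y_i,z_i)\ne 0$ on the ray from the origin through $i$. Let $f_{\mathrm{north}}$ and $f_{\mathrm{south}}$ be the faces that contain the north pole and the south pole, respectively, and assume $f_{\mathrm{north}}\ne f_{\mathrm{south}}$. The other faces are called non-polar; a non-polar face is a down-face if one of its vertices lies directly south (on the same longitude) of some point of the opposite edge. Write each face as a triple $(i,j,k)$ of its vertices in counterclockwise order around its interior. For $z'\in\mathbb{R}^n$ put $$\mathrm{vol}'(i,j,k)=\det\begin{pmatrix}x_i&y_i&z'_i\\x_j&y_j&z'_j\\x_k&y_k&z'_k\end{pmatrix},$$ and consider the sinking linear program in the variables $z'=(z'_1,\dots,z'_n)$: $$\text{maximize }\sum_i z'_i\quad\text{subject to}\quad z'_i=-1\text{ for every vertex } i \text{ of } f_{\mathrm{north}},\qquad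 \mathrm{vol}'(i,j,k)\ge 0\text{ for every non-polar face }(i,j,k).$$ **Theorem.** If $z'$ is an optimal solution of this linear program, then $z'$ is also a solution of the following $n\times n$ linear system: $$z'_i=-1\ \text{ for every vertex } i\text{ of } f_{\mathrm{north}},\qquad \mathrm{vol}'(i,j,k)=0\ \text{ for every down-face }(i,j,k).$$ In particular, the number of vertices of $f_{\mathrm{north}}$ plus the number of down-faces is exactly $n$. -/

import Mathlib

/-!
Points of the unit sphere are unit vectors of `Fin 3 → ℝ`.  A vertex is given by a coordinate vector
in signed homogeneous coordinates: a nonzero vector represents the point of the sphere on its ray.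
-/

/-- The determinant of the matrix with rows `a`, `b`, `c`. -/
def vol (a b c : Fin 3 → ℝ) : ℝ := (Matrix.of ![a, b, c]).det

/-- The unit sphere `x² + y² + z² = 1`. -/
def unitSphere : Set (Fin 3 → ℝ) := {q | q 0 ^ 2 + q 1 ^ 2 + q 2 ^ 2 = 1}

def northPole : Fin 3 → ℝ := ![0, 0, 1]

def southPole : Fin 3 → ℝ := ![0, 0, -1]

/-- The (closed) shortest path on the sphere between the points represented by the linearly
independent vectors `a` and `b`: the great-circular arc of length less than `π`. -/
def geodesicArc (a b : Fin 3 → ℝ) : Set (Fin 3 → ℝ) :=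
  {q | q ∈ unitSphere ∧ ∃ s t : ℝ, 0 ≤ s ∧ 0 ≤ t ∧ q = s • a + t • b}

/-- For linearly independent `a`, `b`, `c`: the open region of the sphere to the left of the closed
curve that consists of the shortest paths from `a` to `b`, from `b` to `c` and from `c` to `a`.
If `vol a b c > 0` it is the open spherical triangle, the set of points to the left of all three
arcs.  If `vol a b c < 0` it is the complement of the closed spherical triangle (a region of area
greater than `2π`, an everted triangle), the set of points to the left of at least one arc. -/
def leftRegion (a b c : Fin 3 → ℝ) : Set (Fin 3 → ℝ) :=
  {q | q ∈ unitSphere ∧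
    ((0 < vol a b c ∧ 0 < vol q b c ∧ 0 < vol a q c ∧ 0 < vol a b q) ∨
     (vol a b c < 0 ∧ (0 < vol q b c ∨ 0 < vol a q c ∨ 0 < vol a b q)))}

section Triangulation

variable {n : ℕ}

/-- The drawing of the graph `G` on the sphere, in which vertex `i` is placed at the point
represented by `p i` and every edge is drawn as a shortest path. -/
def drawing (G : SimpleGraph (Fin n)) (p : Fin n → Fin 3 → ℝ) : Set (Fin 3 → ℝ) :=
  {q | (q ∈ unitSphere ∧ ∃ i, ∃ c : ℝ, 0 < c ∧ q = c • p i) ∨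
    ∃ i j, G.Adj i j ∧ q ∈ geodesicArc (p i) (p j)}

/-- `(i, j, k)` is a face of the drawing with its vertices in counterclockwise order around its
interior: `i j k` is a cycle of three edges, and the region to its left contains no point
of the drawing (so that this region is a connected component of the complement of the drawing).
A face is described by its three cyclic rotations. -/
def IsFace (G : SimpleGraph (Fin n)) (p : Fin n → Fin 3 → ℝ) (i j k : Fin n) : Prop :=
  G.Adj i j ∧ G.Adj j k ∧ G.Adj k i ∧
    Disjoint (leftRegion (p i) (p j) (p k)) (drawing G p)

/-- The graph `G`, with vertices represented by the coordinate vectors `p` and with shortest paths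
as edges, is a generic shortest-path triangulation of the sphere. -/
structure IsGenericTriangulation (G : SimpleGraph (Fin n)) (p : Fin n → Fin 3 → ℝ) : Prop where
  /-- No great circle contains more than two vertices. -/
  generic_circle : ∀ i j k, i ≠ j → j ≠ k → k ≠ i → vol (p i) (p j) (p k) ≠ 0
  /-- No great circle through the poles contains more than one vertex. -/
  generic_pole : ∀ i j, i ≠ j → vol northPole (p i) (p j) ≠ 0
  /-- Two distinct edges meet only at shared endpoints. -/
  embedded : ∀ i j k l, G.Adj i j → G.Adj k l → s(i, j) ≠ s(k, l) →
    ∀ q, q ∈ geodesicArc (p i) (p j) → q ∈ geodesicArc (p k) (p l) →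
      ∃ m, m ∈ s(i, j) ∧ m ∈ s(k, l) ∧ ∃ c : ℝ, 0 < c ∧ q = c • p m
  /-- Every component of the complement of the drawing is bounded by a cycle of three edges. -/
  triangulated : ∀ q, q ∈ unitSphere → q ∉ drawing G p →
    ∃ i j k, IsFace G p i j k ∧ q ∈ leftRegion (p i) (p j) (p k)

/-- The face that contains the north pole. -/
def IsNorthFace (G : SimpleGraph (Fin n)) (p : Fin n → Fin 3 → ℝ) (i j k : Fin n) : Prop :=
  IsFace G p i j k ∧ northPole ∈ leftRegion (p i) (p j) (p k)

/-- The face that contains the south pole. -/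
def IsSouthFace (G : SimpleGraph (Fin n)) (p : Fin n → Fin 3 → ℝ) (i j k : Fin n) : Prop :=
  IsFace G p i j k ∧ southPole ∈ leftRegion (p i) (p j) (p k)

/-- A face that is neither the north face nor the south face. -/
def IsNonPolarFace (G : SimpleGraph (Fin n)) (p : Fin n → Fin 3 → ℝ) (i j k : Fin n) : Prop :=
  IsFace G p i j k ∧ ¬ IsNorthFace G p i j k ∧ ¬ IsSouthFace G p i j k

/-- The point represented by `a` is directly south of the arc from `b` to `c`: some point `r` of the
arc is on the longitude of `a`, and `r` is further north.  The vectors `r` and `t • a` have the same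
`x`- and `y`-coordinates, so their latitudes compare as their `z`-coordinates. -/
def DirectlySouthOf (a b c : Fin 3 → ℝ) : Prop :=
  ∃ r, r ∈ geodesicArc b c ∧
    ∃ t : ℝ, 0 < t ∧ r 0 = t * a 0 ∧ r 1 = t * a 1 ∧ t * a 2 < r 2

/-- A down-face: a non-polar face with a vertex (the apex) directly south of the opposite edge. -/
def IsDownFace (G : SimpleGraph (Fin n)) (p : Fin n → Fin 3 → ℝ) (i j k : Fin n) : Prop :=
  IsNonPolarFace G p i j k ∧
    (DirectlySouthOf (p i) (p j) (p k) ∨ DirectlySouthOf (p j) (p k) (p i) ∨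
      DirectlySouthOf (p k) (p i) (p j))

/-- The vertices of the north face. -/
def northVertices (G : SimpleGraph (Fin n)) (p : Fin n → Fin 3 → ℝ) : Set (Fin n) :=
  {i | ∃ j k, IsNorthFace G p i j k}

/-- The down-faces, each as the set of its three vertices. -/
def downFaces (G : SimpleGraph (Fin n)) (p : Fin n → Fin 3 → ℝ) : Set (Finset (Fin n)) :=
  {f | ∃ i j k, IsDownFace G p i j k ∧ f = {i, j, k}}

/-- `vol'(i,j,k)`: the volume determinant after the `z`-coordinates are replaced by `z'`. -/
def vol' (p : Fin n → Fin 3 → ℝ) (z' : Fin n → ℝ) (i j k : Fin n) : ℝ :=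
  vol ![p i 0, p i 1, z' i] ![p j 0, p j 1, z' j] ![p k 0, p k 1, z' k]

/-- The feasible region of the sinking linear program. -/
def sinkFeasible (G : SimpleGraph (Fin n)) (p : Fin n → Fin 3 → ℝ) : Set (Fin n → ℝ) :=
  {z' | (∀ i ∈ northVertices G p, z' i = -1) ∧
    ∀ i j k, IsNonPolarFace G p i j k → 0 ≤ vol' p z' i j k}

/-- `z'` is an optimal solution of the sinking linear program: it is feasible and maximizes the
sum of the coordinates over the feasible region. -/
def IsSinkOptimal (G : SimpleGraph (Fin n)) (p : Fin n → Fin 3 → ℝ) (z' : Fin n → ℝ) : Prop :=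
  z' ∈ sinkFeasible G p ∧ IsMaxOn (fun z : Fin n → ℝ => ∑ i, z i) (sinkFeasible G p) z'

end Triangulation

/-! `vol'` is linear in the heights, with the wedges of the horizontal projections as coefficients.
Each vertex outside the north face has exactly one face immediately to its north. That face is a
down-face with this vertex as apex, which gives the count (`ncard_downFaces`). Its constraint bounds
the apex height by a positive combination of the heights at the ends of the upper edge, so raising a
vertex can harm no down-face constraint but its own. Starting from the optimal `z'`, one can
therefore raise heights to some `y ≥ z'` at which all down-faces are flat (`exists_flat`). If `y` is
feasible, optimality of `z'` forces `y = z'`.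

What remains is that `y` satisfies the constraints of the other faces too. Feasible heights are
negative (`neg_of_feasible`), and `y` can be kept negative (`not_closed`), so the raised drawing
projects centrally to a horizontal plane below the origin. There every vertex outside the north face
lies strictly between two neighbours from one of its faces, and the north face is the negatively
oriented outer triangle. In such a drawing all other faces are nonnegatively oriented
(`FlatSystem.planeArea_nonneg`).

This last fact rests on an index count. Order the vertices by a linear functional with a tie-break.
Each face has one middle vertex, and at each vertex as many corners pass upward as downward. Since
there are `2n - 4` faces, `n - 2` corners pass upward in total. Each inner vertex has one because it
is crossed by its flat corner, and so does the middle outer vertex; these are already `n - 2`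
vertices. Thus every inner vertex has exactly one upward and one downward corner, for every
functional. Varying the functional shows that the nondegenerate corners around an inner vertex share
one orientation (`LocalFan.same_orientation`), and an extremal choice of vertex then excludes
negative faces. The number of faces is itself found by counting along meridians (`card_triples`). -/

section
-- Cones over spherical triangles
open Filter Topology

/-- Twice the signed area of the projections to the `xy`-plane: positive if `b` is to the east of `a`. -/
def wedge (a b : Fin 3 → ℝ) : ℝ := a 0 * b 1 - a 1 * b 0

theorem wedge_swap (a b : Fin 3 → ℝ) : wedge b a = - wedge a b := by
  unfold wedge; ring

theorem vol_eq (a b c : Fin 3 → ℝ) : vol a b c =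
    a 0 * (b 1 * c 2 - b 2 * c 1) - a 1 * (b 0 * c 2 - b 2 * c 0)
      + a 2 * (b 0 * c 1 - b 1 * c 0) := by
  simp [vol, Matrix.det_fin_three]; ring

theorem vol_rotate (a b c : Fin 3 → ℝ) : vol b c a = vol a b c := by
  simp only [vol_eq]; ring

theorem vol_northPole (a b : Fin 3 → ℝ) : vol northPole a b = wedge a b := by
  simp [vol_eq, northPole, wedge]

theorem cramer_vol (a b c q : Fin 3 → ℝ) :
    vol a b c • q = vol q b c • a + vol a q c • b + vol a b q • c := by
  ext t
  simp only [vol_eq, Pi.add_apply, Pi.smul_apply, smul_eq_mul]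
  fin_cases t <;> simp <;> ring

theorem continuous_vol {X : Type*} [TopologicalSpace X] {f g h : X → Fin 3 → ℝ}
    (hf : Continuous f) (hg : Continuous g) (hh : Continuous h) :
    Continuous fun x => vol (f x) (g x) (h x) := by
  simp only [vol_eq]; fun_prop

/-- The cone over `leftRegion a b c`. -/
def coneRegion (a b c : Fin 3 → ℝ) : Set (Fin 3 → ℝ) :=
  {q | (0 < vol a b c ∧ 0 < vol q b c ∧ 0 < vol a q c ∧ 0 < vol a b q) ∨
     (vol a b c < 0 ∧ (0 < vol q b c ∨ 0 < vol a q c ∨ 0 < vol a b q))}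

theorem mem_leftRegion_iff (a b c q : Fin 3 → ℝ) :
    q ∈ leftRegion a b c ↔ q ∈ unitSphere ∧ q ∈ coneRegion a b c := Iff.rfl

theorem coneRegion_rotate (a b c : Fin 3 → ℝ) : coneRegion b c a = coneRegion a b c := by
  ext q
  simp only [coneRegion, Set.mem_ofPred_eq]
  rw [vol_rotate a b c, vol_rotate a b q, ← vol_rotate q b c, vol_rotate a q c]
  tauto

theorem zero_notMem_coneRegion (a b c : Fin 3 → ℝ) : (0 : Fin 3 → ℝ) ∉ coneRegion a b c := by
  simp [coneRegion, vol_eq]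

theorem smul_mem_coneRegion {a b c q : Fin 3 → ℝ} {r : ℝ} (hr : 0 < r)
    (hq : q ∈ coneRegion a b c) : r • q ∈ coneRegion a b c := by
  have h1 : vol (r • q) b c = r * vol q b c := by
    simp only [vol_eq, Pi.smul_apply, smul_eq_mul]; ring
  have h2 : vol a (r • q) c = r * vol a q c := by
    simp only [vol_eq, Pi.smul_apply, smul_eq_mul]; ring
  have h3 : vol a b (r • q) = r * vol a b q := by
    simp only [vol_eq, Pi.smul_apply, smul_eq_mul]; ring
  simpa only [coneRegion, Set.mem_ofPred_eq, h1, h2, h3, mul_pos_iff_of_pos_left hr] using hq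

theorem isOpen_coneRegion (a b c : Fin 3 → ℝ) : IsOpen (coneRegion a b c) := by
  have h1 : Continuous fun q => vol q b c :=
    continuous_vol continuous_id continuous_const continuous_const
  have h2 : Continuous fun q => vol a q c :=
    continuous_vol continuous_const continuous_id continuous_const
  have h3 : Continuous fun q => vol a b q :=
    continuous_vol continuous_const continuous_const continuous_id
  have o1 := isOpen_lt (continuous_const (y := (0 : ℝ))) h1
  have o2 := isOpen_lt (continuous_const (y := (0 : ℝ))) h2
  have o3 := isOpen_lt (continuous_const (y := (0 : ℝ))) h3
  rcases lt_trichotomy (vol a b c) 0 with h | h | h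
  · convert o1.union (o2.union o3) using 1
    ext q; simp [coneRegion, h, h.not_gt]
  · convert isOpen_empty using 1
    ext q; simp [coneRegion, h]
  · convert o1.inter (o2.inter o3) using 1
    ext q; simp [coneRegion, h, h.not_gt]

theorem isPreconnected_coneRegion (a b c : Fin 3 → ℝ) : IsPreconnected (coneRegion a b c) := by
  have key : ∀ f : (Fin 3 → ℝ) → ℝ, (∀ x y (s t : ℝ), f (s • x + t • y) = s * f x + t * f y) →
      Convex ℝ {q | 0 < f q} := by
    intro f hf x hx y hy s t hs ht hst
    simp only [Set.mem_ofPred_eq] at *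
    rw [hf]
    rcases hs.eq_or_lt with rfl | hs
    · have : t = 1 := by linarith
      subst this; linarith
    · have := mul_pos hs hx
      have := mul_nonneg ht hy.le
      linarith
  have c1 := key (fun q => vol q b c) (by
    intro x y s t; simp only [vol_eq, Pi.add_apply, Pi.smul_apply, smul_eq_mul]; ring)
  have c2 := key (fun q => vol a q c) (by
    intro x y s t; simp only [vol_eq, Pi.add_apply, Pi.smul_apply, smul_eq_mul]; ring)
  have c3 := key (fun q => vol a b q) (by
    intro x y s t; simp only [vol_eq, Pi.add_apply, Pi.smul_apply, smul_eq_mul]; ring)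
  rcases lt_trichotomy (vol a b c) 0 with h | h | h
  -- The vector `-(a + b + c)` lies in all three open half-spaces, so their union is connected.
  · have e1 : vol (-(a + b + c)) b c = - vol a b c := by
      simp only [vol_eq, Pi.add_apply, Pi.neg_apply]; ring
    have e2 : vol a (-(a + b + c)) c = - vol a b c := by
      simp only [vol_eq, Pi.add_apply, Pi.neg_apply]; ring
    have e3 : vol a b (-(a + b + c)) = - vol a b c := by
      simp only [vol_eq, Pi.add_apply, Pi.neg_apply]; ring
    have := c1.isPreconnected.union (-(a + b + c)) (by simp only [Set.mem_ofPred_eq, e1]; linarith)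
      (Or.inl (by simp only [Set.mem_ofPred_eq, e2]; linarith))
      (c2.isPreconnected.union (-(a + b + c)) (by simp only [Set.mem_ofPred_eq, e2]; linarith)
        (by simp only [Set.mem_ofPred_eq, e3]; linarith) c3.isPreconnected)
    convert this using 1
    ext q; simp [coneRegion, h, h.not_gt]
  · convert isPreconnected_empty using 1
    ext q; simp [coneRegion, h]
  · convert (c1.inter (c2.inter c3)).isPreconnected using 1
    ext q; simp [coneRegion, h, h.not_gt]

/-- The boundary of a region consists of the three cones over its arcs. -/
theorem mem_arc_of_mem_closure {a b c q : Fin 3 → ℝ} (hq : q ∈ closure (coneRegion a b c))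
    (hn : q ∉ coneRegion a b c) (hv : vol a b c ≠ 0) :
    (∃ s t : ℝ, 0 ≤ s ∧ 0 ≤ t ∧ q = s • a + t • b) ∨
    (∃ s t : ℝ, 0 ≤ s ∧ 0 ≤ t ∧ q = s • b + t • c) ∨
    (∃ s t : ℝ, 0 ≤ s ∧ 0 ≤ t ∧ q = s • c + t • a) := by
  have h1 : Continuous fun q => vol q b c :=
    continuous_vol continuous_id continuous_const continuous_const
  have h2 : Continuous fun q => vol a q c :=
    continuous_vol continuous_const continuous_id continuous_const
  have h3 : Continuous fun q => vol a b q :=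
    continuous_vol continuous_const continuous_const continuous_id
  have o1 := isClosed_le (continuous_const (y := (0 : ℝ))) h1
  have o2 := isClosed_le (continuous_const (y := (0 : ℝ))) h2
  have o3 := isClosed_le (continuous_const (y := (0 : ℝ))) h3
  have hc := cramer_vol a b c q
  have hq' : q = (vol q b c / vol a b c) • a + (vol a q c / vol a b c) • b
      + (vol a b q / vol a b c) • c := by
    have := congrArg (fun x => (vol a b c)⁻¹ • x) hc
    simpa only [smul_add, smul_smul, inv_mul_cancel₀ hv, one_smul, ← div_eq_inv_mul] using this
  have main : (0 ≤ vol q b c / vol a b c ∧ 0 ≤ vol a q c / vol a b c ∧ 0 ≤ vol a b q / vol a b c)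
      ∧ (vol q b c = 0 ∨ vol a q c = 0 ∨ vol a b q = 0) := by
    rcases hv.lt_or_gt with h | h
    · have hs : coneRegion a b c ⊆ {q | 0 ≤ vol q b c} ∪ ({q | 0 ≤ vol a q c} ∪ {q | 0 ≤ vol a b q}) := by
        intro x hx
        simp only [coneRegion, h, h.not_gt, Set.mem_ofPred_eq, false_and, false_or, true_and] at hx
        exact hx.imp le_of_lt (Or.imp le_of_lt le_of_lt)
      have hcl := closure_minimal hs (o1.union (o2.union o3)) hq
      simp only [coneRegion, h, h.not_gt, Set.mem_ofPred_eq, false_and, false_or, true_and, not_or,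
        not_lt] at hn
      obtain ⟨n1, n2, n3⟩ := hn
      refine ⟨⟨div_nonneg_of_nonpos n1 h.le, div_nonneg_of_nonpos n2 h.le,
        div_nonneg_of_nonpos n3 h.le⟩, ?_⟩
      exact hcl.imp (fun x => le_antisymm n1 x)
        (Or.imp (fun x => le_antisymm n2 x) (fun x => le_antisymm n3 x))
    · have hs : coneRegion a b c ⊆ {q | 0 ≤ vol q b c} ∩ ({q | 0 ≤ vol a q c} ∩ {q | 0 ≤ vol a b q}) := by
        intro x hx
        simp only [coneRegion, h, h.not_gt, Set.mem_ofPred_eq, false_and, or_false, true_and] at hx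
        exact ⟨hx.1.le, hx.2.1.le, hx.2.2.le⟩
      obtain ⟨n1, n2, n3⟩ := closure_minimal hs (o1.inter (o2.inter o3)) hq
      refine ⟨⟨div_nonneg n1 h.le, div_nonneg n2 h.le, div_nonneg n3 h.le⟩, ?_⟩
      simp only [coneRegion, h, h.not_gt, Set.mem_ofPred_eq, false_and, or_false, true_and] at hn
      by_contra hne
      push Not at hne
      exact hn ⟨lt_of_le_of_ne n1 hne.1.symm, lt_of_le_of_ne n2 hne.2.1.symm,
        lt_of_le_of_ne n3 hne.2.2.symm⟩
  obtain ⟨⟨p1, p2, p3⟩, h | h | h⟩ := main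
  · right; left
    exact ⟨_, _, p2, p3, by rw [h] at hq'; simpa using hq'⟩
  · right; right
    exact ⟨_, _, p3, p1, by rw [h] at hq'; simpa [add_comm] using hq'⟩
  · left
    exact ⟨_, _, p1, p2, by rw [h] at hq'; simpa using hq'⟩

theorem left_mem_closure_coneRegion {a b c : Fin 3 → ℝ} (hv : vol a b c ≠ 0) :
    a ∈ closure (coneRegion a b c) := by
  have key : ∀ d : Fin 3 → ℝ, (∀ᶠ e : ℝ in 𝓝[>] 0, a + e • d ∈ coneRegion a b c) →
      a ∈ closure (coneRegion a b c) := by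
    intro d hd
    have ht : Tendsto (fun e : ℝ => a + e • d) (𝓝[>] 0) (𝓝 a) := by
      have : Continuous fun e : ℝ => a + e • d := by fun_prop
      simpa using (this.tendsto 0).mono_left nhdsWithin_le_nhds
    exact mem_closure_of_tendsto ht hd
  rcases hv.lt_or_gt with h | h
  · apply key (-(b + c))
    filter_upwards [self_mem_nhdsWithin] with e he
    refine Or.inr ⟨h, Or.inr (Or.inl ?_)⟩
    have : vol a (a + e • -(b + c)) c = - (e * vol a b c) := by
      simp only [vol_eq, Pi.add_apply, Pi.smul_apply, Pi.neg_apply, smul_eq_mul]; ring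
    rw [this]
    have := mul_neg_of_pos_of_neg (Set.mem_Ioi.1 he) h
    linarith
  · apply key (b + c)
    filter_upwards [self_mem_nhdsWithin] with e he
    have e1 : vol (a + e • (b + c)) b c = vol a b c := by
      simp only [vol_eq, Pi.add_apply, Pi.smul_apply, smul_eq_mul]; ring
    have e2 : vol a (a + e • (b + c)) c = e * vol a b c := by
      simp only [vol_eq, Pi.add_apply, Pi.smul_apply, smul_eq_mul]; ring
    have e3 : vol a b (a + e • (b + c)) = e * vol a b c := by
      simp only [vol_eq, Pi.add_apply, Pi.smul_apply, smul_eq_mul]; ring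
    have := mul_pos (Set.mem_Ioi.1 he) h
    exact Or.inl ⟨h, by rw [e1]; exact h, by rw [e2]; exact this, by rw [e3]; exact this⟩

theorem exists_smul_mem_unitSphere {q : Fin 3 → ℝ} (hq : q ≠ 0) :
    ∃ r : ℝ, 0 < r ∧ r • q ∈ unitSphere := by
  have hpos : 0 < q 0 ^ 2 + q 1 ^ 2 + q 2 ^ 2 := by
    by_contra h
    apply hq
    have h0 : q 0 ^ 2 = 0 := by nlinarith [sq_nonneg (q 0), sq_nonneg (q 1), sq_nonneg (q 2)]
    have h1 : q 1 ^ 2 = 0 := by nlinarith [sq_nonneg (q 0), sq_nonneg (q 1), sq_nonneg (q 2)]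
    have h2 : q 2 ^ 2 = 0 := by nlinarith [sq_nonneg (q 0), sq_nonneg (q 1), sq_nonneg (q 2)]
    ext t
    fin_cases t
    · simpa using h0
    · simpa using h1
    · simpa using h2
  refine ⟨(Real.sqrt (q 0 ^ 2 + q 1 ^ 2 + q 2 ^ 2))⁻¹, by positivity, ?_⟩
  simp only [unitSphere, Set.mem_ofPred_eq, Pi.smul_apply, smul_eq_mul, mul_pow, inv_pow]
  rw [Real.sq_sqrt hpos.le, ← mul_add, ← mul_add]
  exact inv_mul_cancel₀ hpos.ne'
end

/-! ### Cones over the drawing, and faces met near a point of it -/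

section
open Filter Topology

/-- The cone over the shortest path between `a` and `b`. -/
def arcCone (a b : Fin 3 → ℝ) : Set (Fin 3 → ℝ) :=
  {q | ∃ s t : ℝ, 0 ≤ s ∧ 0 ≤ t ∧ q = s • a + t • b}

theorem arcCone_comm (a b : Fin 3 → ℝ) : arcCone a b = arcCone b a := by
  ext q
  constructor <;> rintro ⟨s, t, hs, ht, rfl⟩ <;> exact ⟨t, s, ht, hs, add_comm _ _⟩

theorem vol_eq_zero_of_mem_arcCone {a b q : Fin 3 → ℝ} (h : q ∈ arcCone a b) : vol a b q = 0 := by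
  obtain ⟨s, t, -, -, rfl⟩ := h
  simp only [vol_eq, Pi.add_apply, Pi.smul_apply, smul_eq_mul]; ring

theorem isClosed_arcCone {a b x : Fin 3 → ℝ} (h : vol a b x ≠ 0) : IsClosed (arcCone a b) := by
  have h1 : Continuous fun q => vol q b x / vol a b x :=
    (continuous_vol continuous_id continuous_const continuous_const).div_const _
  have h2 : Continuous fun q => vol a q x / vol a b x :=
    (continuous_vol continuous_const continuous_id continuous_const).div_const _
  have h3 : Continuous fun q => vol a b q :=
    continuous_vol continuous_const continuous_const continuous_id
  have o1 := isClosed_le (continuous_const (y := (0 : ℝ))) h1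
  have o2 := isClosed_le (continuous_const (y := (0 : ℝ))) h2
  have o3 := isClosed_eq h3 (continuous_const (y := (0 : ℝ)))
  convert o1.inter (o2.inter o3) using 1
  ext q
  constructor
  · intro hq
    have h0 := vol_eq_zero_of_mem_arcCone hq
    obtain ⟨s, t, hs, ht, rfl⟩ := hq
    have e1 : vol (s • a + t • b) b x = s * vol a b x := by
      simp only [vol_eq, Pi.add_apply, Pi.smul_apply, smul_eq_mul]; ring
    have e2 : vol a (s • a + t • b) x = t * vol a b x := by
      simp only [vol_eq, Pi.add_apply, Pi.smul_apply, smul_eq_mul]; ring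
    refine ⟨?_, ?_, h0⟩
    · simpa only [Set.mem_ofPred_eq, e1, mul_div_cancel_right₀ _ h] using hs
    · simpa only [Set.mem_ofPred_eq, e2, mul_div_cancel_right₀ _ h] using ht
  · rintro ⟨q1, q2, q3⟩
    refine ⟨_, _, q1, q2, ?_⟩
    have := congrArg (fun y => (vol a b x)⁻¹ • y) (cramer_vol a b x q)
    simp only [Set.mem_ofPred_eq] at q3
    simpa only [smul_add, smul_smul, inv_mul_cancel₀ h, one_smul, ← div_eq_inv_mul, q3, zero_div,
      zero_smul, add_zero] using this

theorem isClosed_ray {a : Fin 3 → ℝ} (h : a ≠ 0) : IsClosed {q | ∃ c : ℝ, 0 ≤ c ∧ q = c • a} := by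
  have hp : 0 < a ⬝ᵥ a := by
    refine lt_of_le_of_ne ?_ (fun h0 => h (dotProduct_self_eq_zero.1 h0.symm))
    exact Finset.sum_nonneg fun i _ => mul_self_nonneg _
  have c1 : Continuous fun q : Fin 3 → ℝ => (q ⬝ᵥ a) / (a ⬝ᵥ a) := by
    simp only [dotProduct]; fun_prop
  convert (isClosed_le (continuous_const (y := (0 : ℝ))) c1).inter
    (isClosed_eq continuous_id (c1.smul (continuous_const (y := a)))) using 1
  ext q
  constructor
  · rintro ⟨c, hc, rfl⟩
    have : (c • a ⬝ᵥ a) / (a ⬝ᵥ a) = c := by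
      rw [smul_dotProduct, smul_eq_mul, mul_div_cancel_right₀ _ hp.ne']
    refine ⟨?_, ?_⟩
    · simpa only [Set.mem_ofPred_eq, this] using hc
    · change c • a = ((c • a ⬝ᵥ a) / (a ⬝ᵥ a)) • a
      rw [this]
  · rintro ⟨h1, h2⟩
    exact ⟨_, h1, h2⟩

section

variable {n : ℕ} {G : SimpleGraph (Fin n)} {p : Fin n → Fin 3 → ℝ}

/-- The cone over the drawing. -/
def coneDrawing (G : SimpleGraph (Fin n)) (p : Fin n → Fin 3 → ℝ) : Set (Fin 3 → ℝ) :=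
  {q | (∃ i, ∃ c : ℝ, 0 < c ∧ q = c • p i) ∨ ∃ i j, G.Adj i j ∧ q ∈ arcCone (p i) (p j)}

theorem mem_drawing_iff {q : Fin 3 → ℝ} (hq : q ∈ unitSphere) :
    q ∈ drawing G p ↔ q ∈ coneDrawing G p := by
  simp only [drawing, coneDrawing, geodesicArc, arcCone, Set.mem_ofPred_eq, hq, true_and]

theorem smul_mem_coneDrawing {q : Fin 3 → ℝ} {r : ℝ} (hr : 0 < r) (hq : q ∈ coneDrawing G p) :
    r • q ∈ coneDrawing G p := by
  rcases hq with ⟨i, c, hc, rfl⟩ | ⟨i, j, hij, s, t, hs, ht, rfl⟩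
  · exact Or.inl ⟨i, r * c, mul_pos hr hc, smul_smul _ _ _⟩
  · exact Or.inr ⟨i, j, hij, r * s, r * t, by positivity, by positivity, by
      rw [smul_add, smul_smul, smul_smul]⟩

theorem IsFace.notMem_coneDrawing {i j k : Fin n} (h : IsFace G p i j k) {q : Fin 3 → ℝ}
    (hq : q ∈ coneRegion (p i) (p j) (p k)) : q ∉ coneDrawing G p := by
  intro hd
  have hq0 : q ≠ 0 := by
    rintro rfl; exact zero_notMem_coneRegion _ _ _ hq
  obtain ⟨r, hr, hu⟩ := exists_smul_mem_unitSphere hq0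
  exact Set.disjoint_left.1 h.2.2.2 ⟨hu, smul_mem_coneRegion hr hq⟩
    ((mem_drawing_iff hu).2 (smul_mem_coneDrawing hr hd))

theorem IsFace.rotate {i j k : Fin n} (h : IsFace G p i j k) : IsFace G p j k i := by
  refine ⟨h.2.1, h.2.2.1, h.1, ?_⟩
  have : leftRegion (p j) (p k) (p i) = leftRegion (p i) (p j) (p k) := by
    ext q
    rw [mem_leftRegion_iff, mem_leftRegion_iff, coneRegion_rotate]
  rw [this]; exact h.2.2.2

namespace IsGenericTriangulation

theorem exists_face (hT : IsGenericTriangulation G p) {q : Fin 3 → ℝ} (hq : q ≠ 0)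
    (hd : q ∉ coneDrawing G p) :
    ∃ i j k, IsFace G p i j k ∧ q ∈ coneRegion (p i) (p j) (p k) := by
  obtain ⟨r, hr, hu⟩ := exists_smul_mem_unitSphere hq
  have hd' : r • q ∉ drawing G p := by
    rw [mem_drawing_iff hu]
    intro h
    apply hd
    have := smul_mem_coneDrawing (inv_pos.2 hr) h
    rwa [inv_smul_smul₀ hr.ne'] at this
  obtain ⟨i, j, k, hf, hm⟩ := hT.triangulated _ hu hd'
  refine ⟨i, j, k, hf, ?_⟩
  have := smul_mem_coneRegion (inv_pos.2 hr) hm.2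
  rwa [inv_smul_smul₀ hr.ne'] at this

theorem vertex_of_mem_arcCone (hT : IsGenericTriangulation G p) {i j m : Fin n} (hij : i ≠ j)
    (h : p m ∈ arcCone (p i) (p j)) : m = i ∨ m = j := by
  by_contra hne
  push Not at hne
  exact hT.generic_circle i j m hij hne.2.symm hne.1 (vol_eq_zero_of_mem_arcCone h)

theorem ray_of_mem_arcCones (hT : IsGenericTriangulation G p) {i j k l : Fin n} (hij : G.Adj i j)
    (hkl : G.Adj k l) (hne : s(i, j) ≠ s(k, l)) {q : Fin 3 → ℝ} (hq : q ≠ 0)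
    (h1 : q ∈ arcCone (p i) (p j)) (h2 : q ∈ arcCone (p k) (p l)) :
    ∃ m, ∃ c : ℝ, 0 < c ∧ q = c • p m := by
  obtain ⟨r, hr, hu⟩ := exists_smul_mem_unitSphere hq
  obtain ⟨s, t, hs, ht, e⟩ := h1
  obtain ⟨s', t', hs', ht', e'⟩ := h2
  obtain ⟨m, -, -, c, hc, h⟩ := hT.embedded i j k l hij hkl hne (r • q)
    ⟨hu, r * s, r * t, by positivity, by positivity, by
      rw [e, smul_add, smul_smul, smul_smul]⟩
    ⟨hu, r * s', r * t', by positivity, by positivity, by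
      rw [e', smul_add, smul_smul, smul_smul]⟩
  refine ⟨m, r⁻¹ * c, by positivity, ?_⟩
  rw [← smul_smul, ← h, inv_smul_smul₀ hr.ne']

theorem vol_ne_zero_of_face (hT : IsGenericTriangulation G p) {i j k : Fin n}
    (h : IsFace G p i j k) : vol (p i) (p j) (p k) ≠ 0 :=
  hT.generic_circle i j k h.1.ne h.2.1.ne h.2.2.1.ne

theorem mem_arc_of_mem_closure (hT : IsGenericTriangulation G p) {i j k : Fin n}
    (h : IsFace G p i j k) {q : Fin 3 → ℝ} (hq : q ∈ closure (coneRegion (p i) (p j) (p k)))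
    (hn : q ∉ coneRegion (p i) (p j) (p k)) :
    q ∈ arcCone (p i) (p j) ∨ q ∈ arcCone (p j) (p k) ∨ q ∈ arcCone (p k) (p i) :=
  _root_.mem_arc_of_mem_closure hq hn (hT.vol_ne_zero_of_face h)

/-- A connected set that meets an open region and avoids its boundary stays inside it. The boundary
of a face consists of edges, and a face contains no point of the drawing. -/
theorem coneRegion_subset (hT : IsGenericTriangulation G p) {i j k i' j' k' : Fin n}
    (h : IsFace G p i j k) (h' : IsFace G p i' j' k')
    (hne : (coneRegion (p i) (p j) (p k) ∩ coneRegion (p i') (p j') (p k')).Nonempty) :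
    coneRegion (p i) (p j) (p k) ⊆ coneRegion (p i') (p j') (p k') := by
  refine (isPreconnected_coneRegion _ _ _).subset_of_closure_inter_subset
    (isOpen_coneRegion _ _ _) hne ?_
  rintro q ⟨hq, hq1⟩
  by_contra hq2
  apply h.notMem_coneDrawing hq1
  rcases hT.mem_arc_of_mem_closure h' hq hq2 with ha | ha | ha
  · exact Or.inr ⟨_, _, h'.1, ha⟩
  · exact Or.inr ⟨_, _, h'.2.1, ha⟩
  · exact Or.inr ⟨_, _, h'.2.2.1, ha⟩

theorem vertex_mem_coneDrawing (i : Fin n) : p i ∈ coneDrawing G p :=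
  Or.inl ⟨i, 1, one_pos, (one_smul _ _).symm⟩

theorem vertex_mem_of_mem_closure (hT : IsGenericTriangulation G p) {i j k m : Fin n}
    (h : IsFace G p i j k) (hm : p m ∈ closure (coneRegion (p i) (p j) (p k))) :
    m = i ∨ m = j ∨ m = k := by
  have hn : p m ∉ coneRegion (p i) (p j) (p k) :=
    fun hq => h.notMem_coneDrawing hq (vertex_mem_coneDrawing m)
  rcases hT.mem_arc_of_mem_closure h hm hn with ha | ha | ha
  · have := hT.vertex_of_mem_arcCone h.1.ne ha; tauto
  · have := hT.vertex_of_mem_arcCone h.2.1.ne ha; tauto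
  · have := hT.vertex_of_mem_arcCone h.2.2.1.ne ha; tauto

theorem left_mem_of_overlap (hT : IsGenericTriangulation G p) {i j k i' j' k' : Fin n}
    (h : IsFace G p i j k) (h' : IsFace G p i' j' k')
    (hne : (coneRegion (p i) (p j) (p k) ∩ coneRegion (p i') (p j') (p k')).Nonempty) :
    i = i' ∨ i = j' ∨ i = k' :=
  hT.vertex_mem_of_mem_closure h' (closure_mono (hT.coneRegion_subset h h' hne)
    (left_mem_closure_coneRegion (hT.vol_ne_zero_of_face h)))

/-- Overlapping faces have the same vertices. -/
theorem vertices_of_overlap (hT : IsGenericTriangulation G p) {i j k i' j' k' : Fin n}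
    (h : IsFace G p i j k) (h' : IsFace G p i' j' k')
    (hne : (coneRegion (p i) (p j) (p k) ∩ coneRegion (p i') (p j') (p k')).Nonempty) :
    (i = i' ∨ i = j' ∨ i = k') ∧ (j = i' ∨ j = j' ∨ j = k') ∧ (k = i' ∨ k = j' ∨ k = k') := by
  refine ⟨hT.left_mem_of_overlap h h' hne, hT.left_mem_of_overlap h.rotate h' ?_,
    hT.left_mem_of_overlap h.rotate.rotate h' ?_⟩
  · rwa [coneRegion_rotate]
  · rwa [coneRegion_rotate, coneRegion_rotate]

/-- If a curve leaves a point of the drawing without touching the drawing, then some face contains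
points of the curve arbitrarily close to its start. -/
theorem exists_face_frequently (hT : IsGenericTriangulation G p) {m d : Fin 3 → ℝ}
    (h : ∀ᶠ e : ℝ in 𝓝[>] 0, m + e • d ∉ coneDrawing G p) (hm : m ≠ 0) (hmd : m ∈ coneDrawing G p) :
    ∃ i j k, IsFace G p i j k ∧ (∃ᶠ e : ℝ in 𝓝[>] 0, m + e • d ∈ coneRegion (p i) (p j) (p k)) ∧
      m ∈ arcCone (p i) (p j) := by
  have ht : Tendsto (fun e : ℝ => m + e • d) (𝓝[>] 0) (𝓝 m) := by
    have : Continuous fun e : ℝ => m + e • d := by fun_prop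
    simpa using (this.tendsto 0).mono_left nhdsWithin_le_nhds
  have hne : ∀ᶠ e : ℝ in 𝓝[>] 0, m + e • d ≠ 0 := ht.eventually_ne hm
  have key : ∃ i j k, IsFace G p i j k ∧
      ∃ᶠ e : ℝ in 𝓝[>] 0, m + e • d ∈ coneRegion (p i) (p j) (p k) := by
    -- Pigeonhole: there are only finitely many triples, so faces that each occur only away from the
    -- start would leave some point uncovered.
    by_contra hcon
    push Not at hcon
    have hall : ∀ᶠ e : ℝ in 𝓝[>] 0, ∀ i j k, IsFace G p i j k →
        m + e • d ∉ coneRegion (p i) (p j) (p k) := by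
      simp only [eventually_all]
      intro i j k hf
      simpa [Filter.not_frequently] using hcon i j k hf
    obtain ⟨e, h1, h2, h3⟩ := (h.and (hne.and hall)).exists
    obtain ⟨i, j, k, hf, hm⟩ := hT.exists_face h2 h1
    exact h3 i j k hf hm
  obtain ⟨i, j, k, hf, hfr⟩ := key
  rcases hT.mem_arc_of_mem_closure hf (mem_closure_of_frequently_of_tendsto hfr ht)
    (fun hq => hf.notMem_coneDrawing hq hmd) with ha | ha | ha
  · exact ⟨i, j, k, hf, hfr, ha⟩
  · exact ⟨j, k, i, hf.rotate, by rwa [coneRegion_rotate], ha⟩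
  · exact ⟨k, i, j, hf.rotate.rotate, by rwa [coneRegion_rotate, coneRegion_rotate], ha⟩

theorem exists_ne_ne (hn : 4 ≤ n) (i j : Fin n) : ∃ k, k ≠ i ∧ k ≠ j := by
  have : ({i, j} : Finset (Fin n)).card < Fintype.card (Fin n) := by
    rw [Fintype.card_fin]; exact lt_of_le_of_lt Finset.card_le_two (by omega)
  obtain ⟨k, hk⟩ := Finset.exists_mem_notMem_of_card_lt_card
    (s := {i, j}) (t := Finset.univ) (by simpa using this)
  exact ⟨k, by simpa using hk⟩

theorem vertex_ne_zero (hn : 4 ≤ n) (hT : IsGenericTriangulation G p) (i : Fin n) : p i ≠ 0 := by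
  obtain ⟨k, hk, -⟩ := exists_ne_ne hn i i
  intro h0
  apply hT.generic_pole i k hk.symm
  simp [h0, vol_eq]

/-- A curve leaves the drawing if it leaves each edge and each vertex. -/
theorem eventually_notMem_coneDrawing (hn : 4 ≤ n) (hT : IsGenericTriangulation G p)
    {m d : Fin 3 → ℝ}
    (hv : ∀ i, (∀ c : ℝ, 0 ≤ c → m ≠ c • p i) ∨
      ∀ᶠ e : ℝ in 𝓝[>] 0, ∀ c : ℝ, m + e • d ≠ c • p i)
    (he : ∀ i j, G.Adj i j → m ∉ arcCone (p i) (p j) ∨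
      ∀ᶠ e : ℝ in 𝓝[>] 0, m + e • d ∉ arcCone (p i) (p j)) :
    ∀ᶠ e : ℝ in 𝓝[>] 0, m + e • d ∉ coneDrawing G p := by
  have ht : Tendsto (fun e : ℝ => m + e • d) (𝓝[>] 0) (𝓝 m) := by
    have : Continuous fun e : ℝ => m + e • d := by fun_prop
    simpa using (this.tendsto 0).mono_left nhdsWithin_le_nhds
  have h1 : ∀ᶠ e : ℝ in 𝓝[>] 0, ∀ i, ¬ ∃ c : ℝ, 0 < c ∧ m + e • d = c • p i := by
    rw [eventually_all]
    intro i
    rcases hv i with h | h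
    · have hm : m ∈ {q | ∃ c : ℝ, 0 ≤ c ∧ q = c • p i}ᶜ := by
        rintro ⟨c, hc, h'⟩; exact h c hc h'
      filter_upwards [ht.eventually
        ((isClosed_ray (vertex_ne_zero hn hT i)).isOpen_compl.mem_nhds hm)] with e he
      rintro ⟨c, hc, h'⟩
      exact he ⟨c, hc.le, h'⟩
    · filter_upwards [h] with e he
      rintro ⟨c, -, h'⟩
      exact he c h'
  have h2 : ∀ᶠ e : ℝ in 𝓝[>] 0, ∀ i j, G.Adj i j → m + e • d ∉ arcCone (p i) (p j) := by
    simp only [eventually_all]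
    intro i j hij
    rcases he i j hij with h | h
    · obtain ⟨k, hki, hkj⟩ := exists_ne_ne hn i j
      exact ht.eventually ((isClosed_arcCone
        (hT.generic_circle i j k hij.ne hkj.symm hki)).isOpen_compl.mem_nhds h)
    · exact h
  filter_upwards [h1, h2] with e e1 e2
  rintro (⟨i, hi⟩ | ⟨i, j, hij, h⟩)
  · exact e1 i hi
  · exact e2 i j hij h

end IsGenericTriangulation

end
end

/-! ### Faces beside an edge and along a meridian -/

section
open Filter Topology

theorem eventually_add_mul_pos {a : ℝ} (ha : 0 < a) (b : ℝ) : ∀ᶠ e : ℝ in 𝓝[>] 0, 0 < a + e * b := by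
  have : Continuous fun e : ℝ => a + e * b := by fun_prop
  have ht := (this.tendsto 0).mono_left (nhdsWithin_le_nhds (s := Set.Ioi 0))
  exact ht.eventually_const_lt (by simpa using ha)

theorem eventually_add_mul_neg {a : ℝ} (ha : a < 0) (b : ℝ) : ∀ᶠ e : ℝ in 𝓝[>] 0, a + e * b < 0 := by
  have : Continuous fun e : ℝ => a + e * b := by fun_prop
  have ht := (this.tendsto 0).mono_left (nhdsWithin_le_nhds (s := Set.Ioi 0))
  exact ht.eventually_lt_const (by simpa using ha)

section

variable {n : ℕ} {G : SimpleGraph (Fin n)} {p : Fin n → Fin 3 → ℝ}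

namespace IsGenericTriangulation

/-- Near an interior point of its edge a face, everted or not, fills the whole left side. Two faces
to the left of the same directed edge therefore overlap. -/
theorem eventually_mem_of_left (hT : IsGenericTriangulation G p) {i j k : Fin n}
    (h : IsFace G p i j k) {d : Fin 3 → ℝ} (hd : 0 < vol (p i) (p j) d) :
    ∀ᶠ e : ℝ in 𝓝[>] 0, p i + p j + e • d ∈ coneRegion (p i) (p j) (p k) := by
  have e3 : ∀ e : ℝ, vol (p i) (p j) (p i + p j + e • d) = e * vol (p i) (p j) d := by
    intro e; simp only [vol_eq, Pi.add_apply, Pi.smul_apply, smul_eq_mul]; ring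
  rcases (hT.vol_ne_zero_of_face h).lt_or_gt with hv | hv
  · filter_upwards [self_mem_nhdsWithin] with e he
    exact Or.inr ⟨hv, Or.inr (Or.inr (by rw [e3]; exact mul_pos he hd))⟩
  · have e1 : ∀ e : ℝ, vol (p i + p j + e • d) (p j) (p k) =
        vol (p i) (p j) (p k) + e * vol d (p j) (p k) := by
      intro e; simp only [vol_eq, Pi.add_apply, Pi.smul_apply, smul_eq_mul]; ring
    have e2 : ∀ e : ℝ, vol (p i) (p i + p j + e • d) (p k) =
        vol (p i) (p j) (p k) + e * vol (p i) d (p k) := by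
      intro e; simp only [vol_eq, Pi.add_apply, Pi.smul_apply, smul_eq_mul]; ring
    filter_upwards [self_mem_nhdsWithin, eventually_add_mul_pos hv _, eventually_add_mul_pos hv _]
      with e he h1 h2
    exact Or.inl ⟨hv, by rw [e1]; exact h1, by rw [e2]; exact h2, by rw [e3]; exact mul_pos he hd⟩

theorem exists_left (hn : 4 ≤ n) (hT : IsGenericTriangulation G p) {i j : Fin n} (hij : i ≠ j) :
    ∃ d, 0 < vol (p i) (p j) d := by
  obtain ⟨k, hki, hkj⟩ := exists_ne_ne hn i j
  refine ⟨vol (p i) (p j) (p k) • p k, ?_⟩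
  have e : vol (p i) (p j) (vol (p i) (p j) (p k) • p k) = vol (p i) (p j) (p k) ^ 2 := by
    simp only [vol_eq, Pi.smul_apply, smul_eq_mul]; ring
  rw [e]
  exact sq_pos_of_ne_zero (hT.generic_circle i j k hij hkj.symm hki)

/-- A directed edge has at most one face to its left. -/
theorem left_face_unique (hn : 4 ≤ n) (hT : IsGenericTriangulation G p) {i j k k' : Fin n}
    (h : IsFace G p i j k) (h' : IsFace G p i j k') : k = k' := by
  obtain ⟨d, hd⟩ := hT.exists_left hn h.1.ne
  obtain ⟨e, h1, h2⟩ := ((hT.eventually_mem_of_left h hd).and (hT.eventually_mem_of_left h' hd)).exists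
  rcases (hT.vertices_of_overlap h h' ⟨_, h1, h2⟩).2.2 with e | e | e
  · exact absurd e h.2.2.1.ne
  · exact absurd e h.2.1.ne.symm
  · exact e

/-- A directed edge has a face to its left. -/
theorem exists_left_face (hn : 4 ≤ n) (hT : IsGenericTriangulation G p) {i j : Fin n}
    (hij : G.Adj i j) : ∃ k, IsFace G p i j k := by
  obtain ⟨d, hd⟩ := hT.exists_left hn hij.ne
  obtain ⟨k, hki, hkj⟩ := exists_ne_ne hn i j
  -- The sum of the end vectors represents an interior point of the edge. It is on no vertex ray, so
  -- by `embedded` no other edge passes through it.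
  have hray : ∀ l (c : ℝ), p i + p j ≠ c • p l := by
    intro l c hc
    have h0 : ∀ x, vol (p l) x (p i + p j) = 0 := by
      intro x; rw [hc]; simp only [vol_eq, Pi.smul_apply, smul_eq_mul]; ring
    by_cases hli : l = i
    · subst hli
      apply hT.generic_circle l k j hki.symm hkj hij.ne.symm
      rw [← h0 (p k)]; simp only [vol_eq, Pi.add_apply]; ring
    by_cases hlj : l = j
    · subst hlj
      apply hT.generic_circle l k i hkj.symm hki hij.ne
      rw [← h0 (p k)]; simp only [vol_eq, Pi.add_apply]; ring
    · apply hT.generic_circle l i j hli hij.ne (Ne.symm hlj)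
      rw [← h0 (p i)]; simp only [vol_eq, Pi.add_apply]; ring
  have hm0 : p i + p j ≠ 0 := fun h => hray i 0 (by simpa using h)
  have hmem : p i + p j ∈ arcCone (p i) (p j) := ⟨1, 1, zero_le_one, zero_le_one, by simp⟩
  have e3 : ∀ e : ℝ, vol (p i) (p j) (p i + p j + e • d) = e * vol (p i) (p j) d := by
    intro e; simp only [vol_eq, Pi.add_apply, Pi.smul_apply, smul_eq_mul]; ring
  have hedge : ∀ a b, G.Adj a b → p i + p j ∈ arcCone (p a) (p b) → s(i, j) = s(a, b) := by
    intro a b hab h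
    by_contra hne
    obtain ⟨m, c, -, h'⟩ := hT.ray_of_mem_arcCones hij hab hne hm0 hmem h
    exact hray m c h'
  have hleave : ∀ᶠ e : ℝ in 𝓝[>] 0, p i + p j + e • d ∉ arcCone (p i) (p j) := by
    filter_upwards [self_mem_nhdsWithin] with e he h
    have := vol_eq_zero_of_mem_arcCone h
    rw [e3] at this
    exact (mul_pos he hd).ne' this
  have hev := eventually_notMem_coneDrawing (G := G) (d := d) hn hT
    (fun l => Or.inl fun c _ => hray l c) (by
      intro a b hab
      by_cases h : p i + p j ∈ arcCone (p a) (p b)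
      · right
        rcases Sym2.eq_iff.1 (hedge a b hab h) with ⟨rfl, rfl⟩ | ⟨rfl, rfl⟩
        · exact hleave
        · rwa [arcCone_comm]
      · exact Or.inl h)
  obtain ⟨i', j', k', hf, hfr, ha⟩ := hT.exists_face_frequently hev hm0 (Or.inr ⟨i, j, hij, hmem⟩)
  rcases Sym2.eq_iff.1 (hedge i' j' hf.1 ha) with ⟨rfl, rfl⟩ | ⟨rfl, rfl⟩
  · exact ⟨k', hf⟩
  -- With the edge reversed, the face would lie on the side opposite to `d`.
  · exfalso
    have e1 : ∀ e : ℝ, vol (p i + p j + e • d) (p i) (p k') =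
        vol (p j) (p i) (p k') + e * vol d (p i) (p k') := by
      intro e; simp only [vol_eq, Pi.add_apply, Pi.smul_apply, smul_eq_mul]; ring
    have e2 : ∀ e : ℝ, vol (p j) (p i + p j + e • d) (p k') =
        vol (p j) (p i) (p k') + e * vol (p j) d (p k') := by
      intro e; simp only [vol_eq, Pi.add_apply, Pi.smul_apply, smul_eq_mul]; ring
    have e3' : ∀ e : ℝ, vol (p j) (p i) (p i + p j + e • d) = - (e * vol (p i) (p j) d) := by
      intro e; simp only [vol_eq, Pi.add_apply, Pi.smul_apply, smul_eq_mul]; ring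
    refine hfr ?_
    rcases (hT.vol_ne_zero_of_face hf).lt_or_gt with hv | hv
    · filter_upwards [self_mem_nhdsWithin, eventually_add_mul_neg hv (vol d (p i) (p k')),
        eventually_add_mul_neg hv (vol (p j) d (p k'))] with e he h1 h2 hq
      have := mul_pos (Set.mem_Ioi.1 he) hd
      rcases hq with ⟨h, -⟩ | ⟨-, h | h | h⟩
      · linarith
      · rw [e1] at h; linarith
      · rw [e2] at h; linarith
      · rw [e3'] at h; linarith
    · filter_upwards [self_mem_nhdsWithin] with e he hq
      have := mul_pos (Set.mem_Ioi.1 he) hd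
      rcases hq with ⟨-, -, -, h⟩ | ⟨h, -⟩
      · rw [e3'] at h; linarith
      · linarith

theorem wedge_ne_zero (hT : IsGenericTriangulation G p) {i j : Fin n} (h : i ≠ j) :
    wedge (p i) (p j) ≠ 0 := by
  rw [← vol_northPole]; exact hT.generic_pole i j h

end IsGenericTriangulation

theorem northPole_mem_iff (a b c : Fin 3 → ℝ) : northPole ∈ leftRegion a b c ↔
    (0 < vol a b c ∧ 0 < wedge b c ∧ 0 < wedge c a ∧ 0 < wedge a b) ∨
     (vol a b c < 0 ∧ (0 < wedge b c ∨ 0 < wedge c a ∨ 0 < wedge a b)) := by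
  have hu : northPole ∈ unitSphere := by simp [northPole, unitSphere]
  rw [mem_leftRegion_iff, coneRegion, Set.mem_ofPred_eq, vol_northPole, ← vol_rotate a northPole c,
    vol_northPole, vol_rotate northPole, vol_northPole]
  simp [hu]

theorem southPole_mem_iff (a b c : Fin 3 → ℝ) : southPole ∈ leftRegion a b c ↔
    (0 < vol a b c ∧ wedge b c < 0 ∧ wedge c a < 0 ∧ wedge a b < 0) ∨
     (vol a b c < 0 ∧ (wedge b c < 0 ∨ wedge c a < 0 ∨ wedge a b < 0)) := by
  have hu : southPole ∈ unitSphere := by simp [southPole, unitSphere]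
  have hs : ∀ a b, vol southPole a b = - wedge a b := by
    intro a b; simp [vol_eq, southPole, wedge]
  rw [mem_leftRegion_iff, coneRegion, Set.mem_ofPred_eq, hs, ← vol_rotate a southPole c,
    hs, vol_rotate southPole, hs]
  simp [hu]

theorem IsNorthFace.rotate {i j k : Fin n} (h : IsNorthFace G p i j k) : IsNorthFace G p j k i := by
  refine ⟨h.1.rotate, ?_⟩
  have := h.2
  rw [mem_leftRegion_iff] at this ⊢
  rwa [coneRegion_rotate]

theorem IsSouthFace.rotate {i j k : Fin n} (h : IsSouthFace G p i j k) : IsSouthFace G p j k i := by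
  refine ⟨h.1.rotate, ?_⟩
  have := h.2
  rw [mem_leftRegion_iff] at this ⊢
  rwa [coneRegion_rotate]

theorem IsNonPolarFace.rotate {i j k : Fin n} (h : IsNonPolarFace G p i j k) :
    IsNonPolarFace G p j k i :=
  ⟨h.1.rotate, fun h' => h.2.1 h'.rotate.rotate, fun h' => h.2.2 h'.rotate.rotate⟩

/-- A generic triangulation with at least four vertices and with no face containing both poles. -/
structure PolarTriangulation (G : SimpleGraph (Fin n)) (p : Fin n → Fin 3 → ℝ) : Prop where
  four_le : 4 ≤ n
  generic : IsGenericTriangulation G p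
  poles : ∀ i j k, ¬ (IsNorthFace G p i j k ∧ IsSouthFace G p i j k)

namespace PolarTriangulation

theorem wedge_ne (hP : PolarTriangulation G p) {i j k : Fin n} (h : IsFace G p i j k) :
    wedge (p i) (p j) ≠ 0 ∧ wedge (p j) (p k) ≠ 0 ∧ wedge (p k) (p i) ≠ 0 :=
  ⟨hP.generic.wedge_ne_zero h.1.ne, hP.generic.wedge_ne_zero h.2.1.ne,
    hP.generic.wedge_ne_zero h.2.2.1.ne⟩

/-- An everted face with wedges of both signs would contain both poles, which `poles` forbids. So
the sign pattern alone decides, whatever the sign of the volume. -/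
theorem northFace_iff (hP : PolarTriangulation G p) {i j k : Fin n} (h : IsFace G p i j k) :
    IsNorthFace G p i j k ↔
      0 < wedge (p i) (p j) ∧ 0 < wedge (p j) (p k) ∧ 0 < wedge (p k) (p i) := by
  obtain ⟨n1, n2, n3⟩ := hP.wedge_ne h
  have hn := northPole_mem_iff (p i) (p j) (p k)
  have hs := southPole_mem_iff (p i) (p j) (p k)
  have hp := hP.poles i j k
  have hv := hP.generic.vol_ne_zero_of_face h
  simp only [IsNorthFace, IsSouthFace, h, true_and, hn, hs] at hp ⊢
  constructor
  · rintro (h1 | h1)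
    · exact ⟨h1.2.2.2, h1.2.1, h1.2.2.1⟩
    · by_contra hc
      apply hp
      refine ⟨Or.inr h1, Or.inr ⟨h1.1, ?_⟩⟩
      by_contra hc'
      push Not at hc'
      exact hc ⟨lt_of_le_of_ne hc'.2.2 n1.symm, lt_of_le_of_ne hc'.1 n2.symm,
        lt_of_le_of_ne hc'.2.1 n3.symm⟩
  · rintro ⟨h1, h2, h3⟩
    rcases hv.lt_or_gt with hv | hv
    · exact Or.inr ⟨hv, Or.inl h2⟩
    · exact Or.inl ⟨hv, h2, h3, h1⟩

theorem southFace_iff (hP : PolarTriangulation G p) {i j k : Fin n} (h : IsFace G p i j k) :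
    IsSouthFace G p i j k ↔
      wedge (p i) (p j) < 0 ∧ wedge (p j) (p k) < 0 ∧ wedge (p k) (p i) < 0 := by
  obtain ⟨n1, n2, n3⟩ := hP.wedge_ne h
  have hn := northPole_mem_iff (p i) (p j) (p k)
  have hs := southPole_mem_iff (p i) (p j) (p k)
  have hp := hP.poles i j k
  have hv := hP.generic.vol_ne_zero_of_face h
  simp only [IsNorthFace, IsSouthFace, h, true_and, hn, hs] at hp ⊢
  constructor
  · rintro (h1 | h1)
    · exact ⟨h1.2.2.2, h1.2.1, h1.2.2.1⟩
    · by_contra hc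
      apply hp
      refine ⟨Or.inr ⟨h1.1, ?_⟩, Or.inr h1⟩
      by_contra hc'
      push Not at hc'
      exact hc ⟨lt_of_le_of_ne hc'.2.2 n1, lt_of_le_of_ne hc'.1 n2, lt_of_le_of_ne hc'.2.1 n3⟩
  · rintro ⟨h1, h2, h3⟩
    rcases hv.lt_or_gt with hv | hv
    · exact Or.inr ⟨hv, Or.inl h2⟩
    · exact Or.inl ⟨hv, h2, h3, h1⟩

/-- An everted face omits only a closed triangle, which cannot contain two antipodal points. The
sign of any one wedge tells which pole is inside. -/
theorem polar_of_vol_neg (hP : PolarTriangulation G p) {i j k : Fin n} (h : IsFace G p i j k)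
    (hv : vol (p i) (p j) (p k) < 0) : IsNorthFace G p i j k ∨ IsSouthFace G p i j k := by
  have hn := northPole_mem_iff (p i) (p j) (p k)
  have hs := southPole_mem_iff (p i) (p j) (p k)
  simp only [IsNorthFace, IsSouthFace, h, true_and, hn, hs]
  rcases (hP.wedge_ne h).1.lt_or_gt with h1 | h1
  · exact Or.inr (Or.inr ⟨hv, Or.inr (Or.inr h1)⟩)
  · exact Or.inl (Or.inr ⟨hv, Or.inr (Or.inr h1)⟩)

theorem vol_pos (hP : PolarTriangulation G p) {i j k : Fin n} (h : IsNonPolarFace G p i j k) :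
    0 < vol (p i) (p j) (p k) := by
  rcases (hP.generic.vol_ne_zero_of_face h.1).lt_or_gt with hv | hv
  · rcases hP.polar_of_vol_neg h.1 hv with h' | h'
    · exact absurd h' h.2.1
    · exact absurd h' h.2.2
  · exact hv

/-- The meridian through a vertex leaves it, in either direction, into a face. -/
theorem exists_meridian_face (hP : PolarTriangulation G p) (v : Fin n) {σ : ℝ} (hσ : σ ≠ 0) :
    ∃ i k, IsFace G p i v k ∧ 0 < σ * wedge (p i) (p v) ∧ 0 < σ * wedge (p v) (p k) := by
  have hT := hP.generic
  have hn := hP.four_le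
  -- Moving from `p v` along `d` follows the meridian, northward if `σ > 0` and southward if `σ <
  -- 0`.
  set d : Fin 3 → ℝ := σ • northPole with hd
  have hw : ∀ a b, vol d a b = σ * wedge a b := by
    intro a b
    rw [← vol_northPole, hd]; simp only [vol_eq, Pi.smul_apply, smul_eq_mul]; ring
  have hne : ∀ u, u ≠ v → vol (p v) (p u) d ≠ 0 := by
    intro u hu
    rw [← vol_rotate, ← vol_rotate, hw]
    exact mul_ne_zero hσ (hT.wedge_ne_zero hu.symm)
  have e3 : ∀ u (e : ℝ), vol (p v) (p u) (p v + e • d) = e * vol (p v) (p u) d := by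
    intro u e; simp only [vol_eq, Pi.add_apply, Pi.smul_apply, smul_eq_mul]; ring
  have hleave : ∀ u, u ≠ v → ∀ᶠ e : ℝ in 𝓝[>] 0, p v + e • d ∉ arcCone (p v) (p u) := by
    intro u hu
    filter_upwards [self_mem_nhdsWithin] with e he h
    have := vol_eq_zero_of_mem_arcCone h
    rw [e3] at this
    exact mul_ne_zero (ne_of_gt he) (hne u hu) this
  have hev := hT.eventually_notMem_coneDrawing (m := p v) (d := d) hn (by
      intro l
      by_cases hl : l = v
      · subst hl
        right
        obtain ⟨u, hu, -⟩ := IsGenericTriangulation.exists_ne_ne hn l l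
        filter_upwards [self_mem_nhdsWithin] with e he c hc
        have := e3 u e
        rw [hc] at this
        have h0 : vol (p l) (p u) (c • p l) = 0 := by
          simp only [vol_eq, Pi.smul_apply, smul_eq_mul]; ring
        rw [h0] at this
        exact mul_ne_zero (ne_of_gt he) (hne u hu) this.symm
      · left
        intro c _ hc
        apply hne l hl
        rw [hc]; simp only [vol_eq, Pi.smul_apply, smul_eq_mul]; ring) (by
      intro a b hab
      by_cases ha : a = v
      · subst ha; exact Or.inr (hleave b hab.ne.symm)
      by_cases hb : b = v
      · subst hb; right; rw [arcCone_comm]; exact hleave a ha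
      · left
        intro h
        rcases hT.vertex_of_mem_arcCone hab.ne h with h | h
        · exact ha h.symm
        · exact hb h.symm)
  obtain ⟨i', j', k', hf, hfr, ha⟩ := hT.exists_face_frequently hev (hT.vertex_ne_zero hn v)
    (IsGenericTriangulation.vertex_mem_coneDrawing v)
  have key : ∃ i k, IsFace G p i v k ∧
      ∃ᶠ e : ℝ in 𝓝[>] 0, p v + e • d ∈ coneRegion (p i) (p v) (p k) := by
    rcases hT.vertex_of_mem_arcCone hf.1.ne ha with rfl | rfl
    · exact ⟨k', j', hf.rotate.rotate, by rwa [coneRegion_rotate, coneRegion_rotate]⟩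
    · exact ⟨i', k', hf, hfr⟩
  obtain ⟨i, k, hf, hfr⟩ := key
  refine ⟨i, k, hf, ?_⟩
  have e1 : ∀ e : ℝ, vol (p v + e • d) (p v) (p k) = e * (σ * wedge (p v) (p k)) := by
    intro e; rw [← hw]; simp only [vol_eq, Pi.add_apply, Pi.smul_apply, smul_eq_mul]; ring
  have e3 : ∀ e : ℝ, vol (p i) (p v) (p v + e • d) = e * (σ * wedge (p i) (p v)) := by
    intro e; rw [← hw]; simp only [vol_eq, Pi.add_apply, Pi.smul_apply, smul_eq_mul]; ring
  have e2 : ∀ e : ℝ, vol (p i) (p v + e • d) (p k) =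
        vol (p i) (p v) (p k) + e * vol (p i) d (p k) := by
      intro e; simp only [vol_eq, Pi.add_apply, Pi.smul_apply, smul_eq_mul]; ring
  rcases (hT.vol_ne_zero_of_face hf).lt_or_gt with hv | hv
  · obtain ⟨e, ⟨h1, he⟩, h2⟩ := ((hfr.and_eventually self_mem_nhdsWithin).and_eventually
      (eventually_add_mul_neg hv (vol (p i) d (p k)))).exists
    have h3 : 0 < σ * wedge (p i) (p v) ∨ 0 < σ * wedge (p v) (p k) := by
      rcases h1 with ⟨h, -⟩ | ⟨-, h | h | h⟩
      · linarith
      · rw [e1] at h; exact Or.inr ((mul_pos_iff_of_pos_left (Set.mem_Ioi.1 he)).1 h)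
      · rw [e2] at h; linarith
      · rw [e3] at h; exact Or.inl ((mul_pos_iff_of_pos_left (Set.mem_Ioi.1 he)).1 h)
    rcases hP.polar_of_vol_neg hf hv with h' | h'
    · rw [hP.northFace_iff hf] at h'
      rcases h3 with h3 | h3
      · have := (mul_pos_iff_of_pos_right h'.1).1 h3
        exact ⟨h3, mul_pos this h'.2.1⟩
      · have := (mul_pos_iff_of_pos_right h'.2.1).1 h3
        exact ⟨mul_pos this h'.1, h3⟩
    · rw [hP.southFace_iff hf] at h'
      have : σ < 0 := by
        rcases h3 with h3 | h3
        · exact neg_of_mul_pos_left h3 h'.1.le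
        · exact neg_of_mul_pos_left h3 h'.2.1.le
      exact ⟨mul_pos_of_neg_of_neg this h'.1, mul_pos_of_neg_of_neg this h'.2.1⟩
  · obtain ⟨e, h1, he⟩ := (hfr.and_eventually self_mem_nhdsWithin).exists
    rcases h1 with ⟨-, h, -, h'⟩ | ⟨h, -⟩
    · rw [e1] at h; rw [e3] at h'
      exact ⟨(mul_pos_iff_of_pos_left (Set.mem_Ioi.1 he)).1 h', (mul_pos_iff_of_pos_left (Set.mem_Ioi.1 he)).1 h⟩
    · linarith

/-- Both faces contain the points of the meridian close to `v` on the side given by `σ`, so they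
overlap and share their vertices. The wedge signs then match the vertices in order. -/
theorem meridian_face_unique (hP : PolarTriangulation G p) {v i k i' k' : Fin n} {σ : ℝ}
    (h : IsFace G p i v k) (h1 : 0 < σ * wedge (p i) (p v)) (h2 : 0 < σ * wedge (p v) (p k))
    (h' : IsFace G p i' v k') (h1' : 0 < σ * wedge (p i') (p v))
    (h2' : 0 < σ * wedge (p v) (p k')) : i = i' ∧ k = k' := by
  have hT := hP.generic
  set d : Fin 3 → ℝ := σ • northPole with hd
  have hw : ∀ a b, vol d a b = σ * wedge a b := by
    intro a b
    rw [← vol_northPole, hd]; simp only [vol_eq, Pi.smul_apply, smul_eq_mul]; ring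
  have key : ∀ i k, IsFace G p i v k → 0 < σ * wedge (p i) (p v) → 0 < σ * wedge (p v) (p k) →
      ∀ᶠ e : ℝ in 𝓝[>] 0, p v + e • d ∈ coneRegion (p i) (p v) (p k) := by
    intro i k h h1 h2
    have e1 : ∀ e : ℝ, vol (p v + e • d) (p v) (p k) = e * (σ * wedge (p v) (p k)) := by
      intro e; rw [← hw]; simp only [vol_eq, Pi.add_apply, Pi.smul_apply, smul_eq_mul]; ring
    have e3 : ∀ e : ℝ, vol (p i) (p v) (p v + e • d) = e * (σ * wedge (p i) (p v)) := by
      intro e; rw [← hw]; simp only [vol_eq, Pi.add_apply, Pi.smul_apply, smul_eq_mul]; ring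
    have e2 : ∀ e : ℝ, vol (p i) (p v + e • d) (p k) =
          vol (p i) (p v) (p k) + e * vol (p i) d (p k) := by
        intro e; simp only [vol_eq, Pi.add_apply, Pi.smul_apply, smul_eq_mul]; ring
    rcases (hT.vol_ne_zero_of_face h).lt_or_gt with hv | hv
    · filter_upwards [self_mem_nhdsWithin] with e he
      exact Or.inr ⟨hv, Or.inl (by rw [e1]; exact mul_pos he h2)⟩
    · filter_upwards [self_mem_nhdsWithin, eventually_add_mul_pos hv _] with e he h3
      exact Or.inl ⟨hv, by rw [e1]; exact mul_pos he h2, by rw [e2]; exact h3,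
        by rw [e3]; exact mul_pos he h1⟩
  obtain ⟨e, m1, m2⟩ := ((key i k h h1 h2).and (key i' k' h' h1' h2')).exists
  obtain ⟨a1, -, a3⟩ := hT.vertices_of_overlap h h' ⟨_, m1, m2⟩
  have hs1 := wedge_swap (p v) (p i)
  have hs2 := wedge_swap (p v) (p k)
  constructor
  · rcases a1 with a | a | a
    · exact a
    · exact absurd a h.1.ne
    · subst a; rw [hs1] at h1; linarith
  · rcases a3 with a | a | a
    · subst a; rw [hs2] at h1'; linarith
    · exact absurd a h.2.1.ne.symm
    · exact a

end PolarTriangulation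
end
end

/-! ### Counting corners in a closed triangulated surface -/

section
open Finset
open scoped Classical

/-- The oriented triangles of a closed triangulated surface: `F a b c` holds if `a`, `b`, `c` are the
vertices of a face in counterclockwise order. -/
structure FaceSystem {V : Type*} (F : V → V → V → Prop) : Prop where
  rotate : ∀ {a b c}, F a b c → F b c a
  ne : ∀ {a b c}, F a b c → a ≠ b
  unique : ∀ {a b c c'}, F a b c → F a b c' → c = c'
  opposite : ∀ {a b c}, F a b c → ∃ d, F b a d

namespace FaceSystem

section
variable {V : Type*} [Fintype V] {F : V → V → V → Prop}

/-- The corners of the faces at the vertex `a`. -/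
noncomputable def corners (F : V → V → V → Prop) (a : V) : Finset (V × V) :=
  univ.filter fun x => F a x.1 x.2

/-- All faces, each with its three rotations. -/
noncomputable def triples (F : V → V → V → Prop) : Finset (V × V × V) :=
  univ.filter fun x => F x.1 x.2.1 x.2.2

theorem mem_corners {a : V} {x : V × V} : x ∈ corners F a ↔ F a x.1 x.2 := by simp [corners]

theorem mem_triples {x : V × V × V} : x ∈ triples F ↔ F x.1 x.2.1 x.2.2 := by simp [triples]

/-- At each vertex as many corners leave a set of neighbours as enter it. -/
theorem balance (hF : FaceSystem F) (a : V) (W : V → Prop) :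
    ((corners F a).filter fun x => W x.1 ∧ ¬ W x.2).card =
      ((corners F a).filter fun x => ¬ W x.1 ∧ W x.2).card := by
  -- Both numbers count the neighbours of `a` in `W`: each neighbour comes first in exactly one
  -- corner and second in exactly one.
  have h1 : ((corners F a).filter fun x => W x.1).card =
      ((corners F a).filter fun x => W x.2).card := by
    have e1 : ((corners F a).filter fun x => W x.1).card =
        (univ.filter fun b => W b ∧ ∃ c, F a b c).card := by
      refine card_bij (fun x _ => x.1) ?_ ?_ ?_
      · intro x hx
        simp only [mem_filter, mem_corners, mem_univ, true_and] at hx ⊢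
        exact ⟨hx.2, _, hx.1⟩
      · intro x hx y hy h
        simp only [mem_filter, mem_corners] at hx hy
        have hx1 := hx.1
        rw [h] at hx1
        exact Prod.ext h (hF.unique hx1 hy.1)
      · intro b hb
        simp only [mem_filter, mem_univ, true_and] at hb
        obtain ⟨hW, c, hc⟩ := hb
        exact ⟨(b, c), by simp [mem_corners, hc, hW], rfl⟩
    have e2 : ((corners F a).filter fun x => W x.2).card =
        (univ.filter fun b => W b ∧ ∃ c, F a b c).card := by
      refine card_bij (fun x _ => x.2) ?_ ?_ ?_
      · intro x hx
        simp only [mem_filter, mem_corners, mem_univ, true_and] at hx ⊢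
        exact ⟨hx.2, hF.opposite (hF.rotate (hF.rotate hx.1))⟩
      · intro x hx y hy h
        simp only [mem_filter, mem_corners] at hx hy
        have hx1 := hF.rotate (hF.rotate hx.1)
        rw [h] at hx1
        exact Prod.ext (hF.unique hx1 (hF.rotate (hF.rotate hy.1))) h
      · intro b hb
        simp only [mem_filter, mem_univ, true_and] at hb
        obtain ⟨hW, c, hc⟩ := hb
        obtain ⟨d, hd⟩ := hF.opposite hc
        exact ⟨(d, b), by simp [mem_corners, hF.rotate hd, hW], rfl⟩
    rw [e1, e2]
  have h2 := card_filter_add_card_filter_not (s := (corners F a).filter fun x => W x.1)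
    (fun x => W x.2)
  have h3 := card_filter_add_card_filter_not (s := (corners F a).filter fun x => W x.2)
    (fun x => W x.1)
  simp only [filter_filter] at h2 h3
  have c1 : ((corners F a).filter fun x => W x.2 ∧ W x.1) =
      (corners F a).filter fun x => W x.1 ∧ W x.2 := filter_congr fun x _ => and_comm
  have c2 : ((corners F a).filter fun x => W x.2 ∧ ¬ W x.1) =
      (corners F a).filter fun x => ¬ W x.1 ∧ W x.2 := filter_congr fun x _ => and_comm
  rw [c1, c2] at h3
  omega

/-- This replaces the cyclic order of the neighbours. It holds even if the link of `a` were to split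
into several cycles. -/
theorem exists_enter (hF : FaceSystem F) {a : V} (W : V → Prop)
    (h : ∃ b c, F a b c ∧ W b ∧ ¬ W c) : ∃ b c, F a b c ∧ ¬ W b ∧ W c := by
  obtain ⟨b, c, hf, h1, h2⟩ := h
  have hpos : 0 < ((corners F a).filter fun x => W x.1 ∧ ¬ W x.2).card :=
    card_pos.2 ⟨(b, c), by simp [mem_corners, hf, h1, h2]⟩
  rw [hF.balance] at hpos
  obtain ⟨x, hx⟩ := card_pos.1 hpos
  simp only [mem_filter, mem_corners] at hx
  exact ⟨x.1, x.2, hx⟩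

theorem sum_triples (g : V × V × V → ℕ) :
    ∑ x ∈ triples F, g x = ∑ a, ∑ x ∈ corners F a, g (a, x) := by
  simp only [triples, corners, sum_filter, Fintype.sum_prod_type]

theorem sum_triples_rotate (hF : FaceSystem F) (g : V × V × V → ℕ) :
    ∑ x ∈ triples F, g (x.2.1, x.2.2, x.1) = ∑ x ∈ triples F, g x := by
  refine sum_bij (fun x _ => (x.2.1, x.2.2, x.1)) ?_ ?_ ?_ ?_
  · intro x hx
    rw [mem_triples] at hx ⊢
    exact hF.rotate hx
  · rintro ⟨a, b, c⟩ _ ⟨a', b', c'⟩ _ h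
    simp only [Prod.mk.injEq] at h ⊢
    tauto
  · rintro ⟨a, b, c⟩ h
    rw [mem_triples] at h
    exact ⟨(c, a, b), by rw [mem_triples]; exact hF.rotate (hF.rotate h), rfl⟩
  · intro x _; rfl

theorem three_mul_sum_triples (hF : FaceSystem F) (g : V × V × V → ℕ) :
    3 * ∑ x ∈ triples F, g x =
      ∑ x ∈ triples F, (g x + g (x.2.1, x.2.2, x.1) + g (x.2.2, x.1, x.2.1)) := by
  rw [sum_add_distrib, sum_add_distrib, hF.sum_triples_rotate g,
    ← hF.sum_triples_rotate fun x => g (x.2.2, x.1, x.2.1)]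
  ring

variable {α : Type*} [LinearOrder α] {ℓ : V → α}

/-- The corners at `a` at which the order `ℓ` increases through `a`. -/
noncomputable def up (F : V → V → V → Prop) (ℓ : V → α) (a : V) : Finset (V × V) :=
  (corners F a).filter fun x => ℓ x.1 < ℓ a ∧ ℓ a < ℓ x.2

/-- The corners at `a` at which the order `ℓ` decreases through `a`. -/
noncomputable def down (F : V → V → V → Prop) (ℓ : V → α) (a : V) : Finset (V × V) :=
  (corners F a).filter fun x => ℓ a < ℓ x.1 ∧ ℓ x.2 < ℓ a

theorem mem_up {a : V} {x : V × V} : x ∈ up F ℓ a ↔ F a x.1 x.2 ∧ ℓ x.1 < ℓ a ∧ ℓ a < ℓ x.2 := by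
  simp [up, mem_corners]

theorem mem_down {a : V} {x : V × V} :
    x ∈ down F ℓ a ↔ F a x.1 x.2 ∧ ℓ a < ℓ x.1 ∧ ℓ x.2 < ℓ a := by
  simp [down, mem_corners]

theorem card_down (hF : FaceSystem F) (hℓ : Function.Injective ℓ) (a : V) :
    (down F ℓ a).card = (up F ℓ a).card := by
  have h := hF.balance a (fun b => ℓ b < ℓ a)
  have key : ∀ {x : V × V}, x ∈ corners F a →
      (¬ ℓ x.1 < ℓ a ↔ ℓ a < ℓ x.1) ∧ (¬ ℓ x.2 < ℓ a ↔ ℓ a < ℓ x.2) := by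
    intro x hx
    rw [mem_corners] at hx
    have n1 := hℓ.ne (hF.ne hx)
    have n2 := hℓ.ne (hF.ne (hF.rotate (hF.rotate hx)))
    exact ⟨by rw [not_lt, le_iff_lt_or_eq]; tauto,
      by rw [not_lt, le_iff_lt_or_eq]; constructor <;> [(rintro (h | h) <;> [exact h; exact absurd h.symm n2]); exact Or.inl]⟩
  have e1 : up F ℓ a = (corners F a).filter fun x => ℓ x.1 < ℓ a ∧ ¬ ℓ x.2 < ℓ a :=
    filter_congr fun x hx => by rw [(key hx).2]
  have e2 : down F ℓ a = (corners F a).filter fun x => ¬ ℓ x.1 < ℓ a ∧ ℓ x.2 < ℓ a :=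
    filter_congr fun x hx => by rw [(key hx).1]
  rw [e1, e2]
  convert h.symm

/-- Each face has exactly one `ℓ`-middle vertex and gives one up- or down-corner there. Ups and
downs balance, so the up-corners are half as many as the faces. In `triples` every face appears
three times. -/
theorem sum_card_up (hF : FaceSystem F) (hℓ : Function.Injective ℓ)
    (hT : (triples F).card + 12 = 6 * Fintype.card V) :
    ∑ a, (up F ℓ a).card + 2 = Fintype.card V := by
  set g : V × V × V → ℕ := fun x =>
    (if ℓ x.2.1 < ℓ x.1 ∧ ℓ x.1 < ℓ x.2.2 then 1 else 0)
      + (if ℓ x.1 < ℓ x.2.1 ∧ ℓ x.2.2 < ℓ x.1 then 1 else 0) with hg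
  have h1 : ∑ x ∈ triples F, g x = 2 * ∑ a, (up F ℓ a).card := by
    rw [sum_triples, mul_sum]
    refine sum_congr rfl fun a _ => ?_
    simp only [hg, sum_add_distrib, ← card_filter]
    have := hF.card_down hℓ a
    simp only [up, down] at this ⊢
    omega
  have h2 : 3 * ∑ x ∈ triples F, g x = (triples F).card := by
    rw [hF.three_mul_sum_triples, card_eq_sum_ones]
    refine sum_congr rfl ?_
    rintro ⟨a, b, c⟩ hx
    rw [mem_triples] at hx
    have n1 := hℓ.ne (hF.ne hx)
    have n2 := hℓ.ne (hF.ne (hF.rotate hx))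
    have n3 := hℓ.ne (hF.ne (hF.rotate (hF.rotate hx)))
    simp only [hg]
    rcases n1.lt_or_gt with h1 | h1 <;> rcases n2.lt_or_gt with h2 | h2 <;>
      rcases n3.lt_or_gt with h3 | h3 <;>
      simp [h1, h2, h3, h1.not_gt, h2.not_gt, h3.not_gt]
    · exact absurd (h1.trans (h2.trans h3)) (lt_irrefl _)
    · exact absurd (h3.trans (h2.trans h1)) (lt_irrefl _)
  omega

/-- If every vertex outside of a face `m b c` with `ℓ`-middle vertex `m` is crossed by `ℓ`, then each
vertex except for `b` and `c` has exactly one increasing corner, and `b` and `c` have none. -/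
theorem card_up_eq (hF : FaceSystem F) (hℓ : Function.Injective ℓ)
    (hT : (triples F).card + 12 = 6 * Fintype.card V) {m b c : V} (hm : F m b c)
    (hmid : (ℓ b < ℓ m ∧ ℓ m < ℓ c) ∨ (ℓ m < ℓ b ∧ ℓ c < ℓ m))
    (hD : ∀ v, v ≠ m → v ≠ b → v ≠ c →
      ∃ i k, F v i k ∧ ((ℓ i < ℓ v ∧ ℓ v < ℓ k) ∨ (ℓ v < ℓ i ∧ ℓ k < ℓ v))) (v : V) :
    (up F ℓ v).card = if v = b ∨ v = c then 0 else 1 := by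
  have key : ∀ v i k, F v i k → ((ℓ i < ℓ v ∧ ℓ v < ℓ k) ∨ (ℓ v < ℓ i ∧ ℓ k < ℓ v)) →
      1 ≤ (up F ℓ v).card := by
    rintro v i k hf (h | h)
    · exact card_pos.2 ⟨(i, k), mem_up.2 ⟨hf, h⟩⟩
    · rw [← hF.card_down hℓ]
      exact card_pos.2 ⟨(i, k), mem_down.2 ⟨hf, h⟩⟩
  have hle : ∀ v ∈ univ, (if v = b ∨ v = c then 0 else 1) ≤ (up F ℓ v).card := by
    intro v _
    split_ifs with h
    · exact Nat.zero_le _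
    · push Not at h
      by_cases hvm : v = m
      · subst hvm; exact key _ _ _ hm hmid
      · obtain ⟨i, k, hf, h'⟩ := hD v hvm h.1 h.2
        exact key _ _ _ hf h'
  have hsum : ∑ v : V, (if v = b ∨ v = c then 0 else 1) + 2 = Fintype.card V := by
    have hbc : b ≠ c := hF.ne (hF.rotate hm)
    have e : ∑ v : V, (if v = b ∨ v = c then 0 else 1) = (({b, c} : Finset V)ᶜ).card := by
      rw [card_eq_sum_ones, ← sum_filter_add_sum_filter_not univ (fun v => v = b ∨ v = c)]
      rw [sum_eq_zero (s := univ.filter fun v => v = b ∨ v = c) (by simp +contextual), zero_add]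
      refine sum_congr (by ext; simp) (by simp +contextual)
    rw [e, card_compl, card_pair hbc]
    have : ({b, c} : Finset V).card ≤ Fintype.card V := card_le_univ _
    rw [card_pair hbc] at this
    omega
  -- The pointwise lower bounds already add up to this total, so each of them is attained.
  have heq := hF.sum_card_up hℓ hT
  exact ((sum_eq_sum_iff_of_le hle).1 (by omega) v (mem_univ v)).symm

end

end FaceSystem
end

/-! ### Fans of vectors around a flat corner -/

section
open scoped Classical

/-- The vector `(x, y)` is positive for the lexicographic order given by the functionals
`(α, β)` and `(γ, δ)`. -/
def LexPos (α β γ δ x y : ℝ) : Prop := 0 < α * x + β * y ∨ (α * x + β * y = 0 ∧ 0 < γ * x + δ * y)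

def LexNeg (α β γ δ x y : ℝ) : Prop := α * x + β * y < 0 ∨ (α * x + β * y = 0 ∧ γ * x + δ * y < 0)

/-- The fan of neighbours `(x u, y u)` around the origin: the corner `C k i` is flat, and every
lexicographic order has only this corner as a decreasing corner if it is positive at `k`, and
increases at most once. -/
structure LocalFan {V : Type*} (x y : V → ℝ) (C : V → V → Prop) (k i : V) : Prop where
  ne_zero : ∀ b c, C b c → (x b ≠ 0 ∨ y b ≠ 0) ∧ (x c ≠ 0 ∨ y c ≠ 0)
  corner : C k i
  flat : x k * y i - y k * x i = 0
  noDown : ∀ α β γ δ : ℝ, α * δ - β * γ ≠ 0 → LexPos α β γ δ (x k) (y k) →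
    ∀ b c, C b c → LexPos α β γ δ (x b) (y b) → LexNeg α β γ δ (x c) (y c) → b = k ∧ c = i
  upUnique : ∀ α β γ δ : ℝ, α * δ - β * γ ≠ 0 → LexPos α β γ δ (x k) (y k) →
    ∀ b c b' c', C b c → LexNeg α β γ δ (x b) (y b) → LexPos α β γ δ (x c) (y c) →
      C b' c' → LexNeg α β γ δ (x b') (y b') → LexPos α β γ δ (x c') (y c') → b = b' ∧ c = c'
  enter : ∀ W : V → Prop, (∃ b c, C b c ∧ W b ∧ ¬ W c) → ∃ b c, C b c ∧ ¬ W b ∧ W c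

/-- Two independent functionals vanish together only at the origin. The tie-break thus makes every
order total, even when neighbours are collinear. -/
theorem lexNeg_of_not_lexPos {α β γ δ x y : ℝ} (hd : α * δ - β * γ ≠ 0) (h0 : x ≠ 0 ∨ y ≠ 0)
    (h : ¬ LexPos α β γ δ x y) : LexNeg α β γ δ x y := by
  simp only [LexPos, not_or, not_and, not_lt] at h
  rcases h.1.lt_or_eq with h1 | h1
  · exact Or.inl h1
  · refine Or.inr ⟨h1, lt_of_le_of_ne (h.2 h1) fun h2 => ?_⟩
    have hx : (α * δ - β * γ) * x = 0 := by linear_combination δ * h1 - β * h2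
    have hy : (α * δ - β * γ) * y = 0 := by linear_combination α * h2 - γ * h1
    rcases h0 with h0 | h0
    · exact h0 ((mul_eq_zero.1 hx).resolve_left hd)
    · exact h0 ((mul_eq_zero.1 hy).resolve_left hd)

theorem not_lexPos_of_lexNeg {α β γ δ x y : ℝ} (h : LexNeg α β γ δ x y) : ¬ LexPos α β γ δ x y := by
  rintro (h1 | h1) <;> rcases h with h | h <;> linarith

theorem sq_add_sq_pos {x y : ℝ} (h : x ≠ 0 ∨ y ≠ 0) : 0 < x * x + y * y := by
  rcases h with h | h
  · have := mul_self_pos.2 h; nlinarith [mul_self_nonneg y]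
  · have := mul_self_pos.2 h; nlinarith [mul_self_nonneg x]

namespace LocalFan

variable {V : Type*} {x y : V → ℝ} {C : V → V → Prop} {k i : V}

/-- Lets statements about positively oriented corners be applied to negatively oriented ones. -/
theorem reflect (h : LocalFan x y C k i) : LocalFan x (fun u => - y u) C k i where
  ne_zero b c hc := by simpa using h.ne_zero b c hc
  corner := h.corner
  flat := by have := h.flat; linarith
  noDown α β γ δ hd hk b c hc hb hc' := by
    refine h.noDown α (-β) γ (-δ) (by intro h0; apply hd; linarith) ?_ b c hc ?_ ?_
    · simpa only [LexPos, neg_mul, mul_neg] using hk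
    · simpa only [LexPos, neg_mul, mul_neg] using hb
    · simpa only [LexNeg, neg_mul, mul_neg] using hc'
  upUnique α β γ δ hd hk b c b' c' hc h1 h2 hc' h3 h4 := by
    refine h.upUnique α (-β) γ (-δ) (by intro h0; apply hd; linarith) ?_ b c b' c' hc ?_ ?_ hc' ?_ ?_
    · simpa only [LexPos, neg_mul, mul_neg] using hk
    · simpa only [LexNeg, neg_mul, mul_neg] using h1
    · simpa only [LexPos, neg_mul, mul_neg] using h2
    · simpa only [LexNeg, neg_mul, mul_neg] using h3
    · simpa only [LexPos, neg_mul, mul_neg] using h4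
  enter := h.enter

/-- The neighbours at a positively oriented corner are not to the left of the flat corner. -/
theorem nonpos_of_pos (h : LocalFan x y C k i) {b c : V} (hc : C b c)
    (hp : 0 < x b * y c - y b * x c) :
    x k * y b - y k * x b ≤ 0 ∧ x k * y c - y k * x c ≤ 0 := by
  have hne : ¬ (b = k ∧ c = i) := by
    rintro ⟨rfl, rfl⟩; have := h.flat; linarith
  obtain ⟨hb0, hc0⟩ := h.ne_zero b c hc
  have hb0 := sq_add_sq_pos hb0
  have hc0 := sq_add_sq_pos hc0
  constructor
  · by_contra hcon
    push Not at hcon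
    -- The order sorts by the sides of the line through `b`, with ties in favour of `b`. Then `k`
    -- and `b` are positive and `c` is negative, so `b c` would be a second down-corner. Below, the
    -- line through `c` is used with ties against `c`.
    refine hne (h.noDown (y b) (-x b) (x b) (y b) (by nlinarith) (Or.inl (by linarith)) b c hc
      (Or.inr ⟨by ring, by linarith⟩) (Or.inl (by linarith)))
  · by_contra hcon
    push Not at hcon
    refine hne (h.noDown (y c) (-x c) (-x c) (-y c) (by nlinarith) (Or.inl (by linarith)) b c hc
      (Or.inl (by linarith)) (Or.inr ⟨by ring, by linarith⟩))

/-- If there is a positively oriented corner, then some corner enters the right side of the flat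
corner. -/
theorem exists_enter_of_pos (h : LocalFan x y C k i) {b c : V} (hc : C b c)
    (hp : 0 < x b * y c - y b * x c) :
    ∃ b c, C b c ∧ ¬ x k * y b - y k * x b < 0 ∧ x k * y c - y k * x c < 0 := by
  by_contra hno
  have hno' : ∀ b c, C b c → x k * y b - y k * x b < 0 → x k * y c - y k * x c < 0 := by
    intro b c hc hb
    by_contra hcc
    exact hno (h.enter (fun u => x k * y u - y k * x u < 0) ⟨b, c, hc, hb, hcc⟩)
  push Not at hno
  obtain ⟨hb, hcc⟩ := h.nonpos_of_pos hc hp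
  have hk0 := sq_add_sq_pos (h.ne_zero _ _ h.corner).1
  have hbc : x k * y b - y k * x b < 0 ∧ x k * y c - y k * x c < 0 := by
    by_cases h1 : x k * y b - y k * x b < 0
    · exact ⟨h1, hno' b c hc h1⟩
    · exfalso
      have h2 := hno b c hc (not_lt.1 h1)
      have e1 : x k * y b - y k * x b = 0 := le_antisymm hb (not_lt.1 h1)
      have e2 : x k * y c - y k * x c = 0 := le_antisymm hcc h2
      have : (x k * x k + y k * y k) * (x b * y c - y b * x c) = 0 := by
        linear_combination (x k * x b + y k * y b) * e2 - (x k * x c + y k * y c) * e1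
      rcases mul_eq_zero.1 this with h | h <;> linarith
  -- Sort by the sides of the line through the sum of `b` and `c`, which separates them and makes
  -- `k` positive. The corner `b c` enters the positive part of the right side, so another corner
  -- leaves that part. It stays on the right by `hno'`, hence is a down-corner that does not start
  -- at `k`.
  set mx := x b + x c with hmx
  set my := y b + y c with hmy
  have hm0 : 0 < mx * mx + my * my := by
    apply sq_add_sq_pos
    by_contra hcon
    push Not at hcon
    have : y c = - y b := by linarith [hcon.2]
    have h' : x c = - x b := by linarith [hcon.1]
    rw [this, h'] at hp
    linarith
  have hd : -my * my - mx * mx ≠ 0 := by linarith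
  have hk : LexPos (-my) mx mx my (x k) (y k) := Or.inl (by rw [hmx, hmy]; linarith [hbc.1, hbc.2])
  have hbn : LexNeg (-my) mx mx my (x b) (y b) := Or.inl (by rw [hmx, hmy]; linarith)
  have hcp : LexPos (-my) mx mx my (x c) (y c) := Or.inl (by rw [hmx, hmy]; linarith)
  have := h.enter (fun u => ¬ (x k * y u - y k * x u < 0 ∧ LexPos (-my) mx mx my (x u) (y u)))
    ⟨b, c, hc, fun h' => not_lexPos_of_lexNeg hbn h'.2, fun h' => h' ⟨hbc.2, hcp⟩⟩
  obtain ⟨b2, c2, hc2, hb2, hcc2⟩ := this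
  rw [not_not] at hb2
  have hc2L := hno' b2 c2 hc2 hb2.1
  have hc2n := lexNeg_of_not_lexPos hd (h.ne_zero _ _ hc2).2 (fun h' => hcc2 ⟨hc2L, h'⟩)
  obtain ⟨rfl, -⟩ := h.noDown _ _ _ _ hd hk b2 c2 hc2 hb2.2 hc2n
  linarith [hb2.1]

/-- All nondegenerate corners have the same orientation. -/
theorem same_orientation (h : LocalFan x y C k i) {b c b' c' : V} (hc : C b c)
    (hp : 0 < x b * y c - y b * x c) (hc' : C b' c') (hn : x b' * y c' - y b' * x c' < 0) :
    False := by
  obtain ⟨b1, c1, hc1, hb1, hcc1⟩ := h.exists_enter_of_pos hc hp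
  have hU := h.reflect.exists_enter_of_pos hc' (by linarith)
  -- Balance turns the corner that enters the left side into one that leaves it.
  have hU' := h.enter (fun u => ¬ (x k * -y u - -y k * x u < 0)) (by
    obtain ⟨b, c, h1, h2, h3⟩ := hU
    exact ⟨b, c, h1, h2, not_not.2 h3⟩)
  obtain ⟨b2, c2, hc2, hb2, hcc2⟩ := hU'
  rw [not_not] at hb2
  have hk0 := sq_add_sq_pos (h.ne_zero _ _ h.corner).1
  have hflat := h.flat
  -- The two orders have opposite sides of the line through `k` as positive side and break ties in
  -- the direction of `k`. The corner entering the right side and the one leaving the left side are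
  -- both up-corners of the first order, hence equal. That corner crosses from strictly left to
  -- strictly right, so in the second order it is a forbidden down-corner.
  have hd1 : y k * y k - (-x k) * x k ≠ 0 := by linarith
  have hd2 : -y k * y k - x k * x k ≠ 0 := by linarith
  have hk1 : LexPos (y k) (-x k) (x k) (y k) (x k) (y k) := Or.inr ⟨by ring, hk0⟩
  have hk2 : LexPos (-y k) (x k) (x k) (y k) (x k) (y k) := Or.inr ⟨by ring, hk0⟩
  have hb1n : LexNeg (y k) (-x k) (x k) (y k) (x b1) (y b1) := by
    apply lexNeg_of_not_lexPos hd1 (h.ne_zero _ _ hc1).1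
    rintro (h1 | h1)
    · apply hb1; linarith
    · obtain ⟨-, rfl⟩ := h.noDown _ _ _ _ hd2 hk2 b1 c1 hc1 (Or.inr ⟨by linarith, h1.2⟩)
        (Or.inl (by linarith))
      linarith
  have hc2p : LexPos (y k) (-x k) (x k) (y k) (x c2) (y c2) := by
    by_contra hcon
    rcases lexNeg_of_not_lexPos hd1 (h.ne_zero _ _ hc2).2 hcon with h1 | h1
    · apply hcc2; linarith
    · obtain ⟨rfl, -⟩ := h.noDown _ _ _ _ hd2 hk2 b2 c2 hc2 (Or.inl (by linarith))
        (Or.inr ⟨by linarith, h1.2⟩)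
      linarith
  obtain ⟨rfl, rfl⟩ := h.upUnique _ _ _ _ hd1 hk1 b1 c1 b2 c2 hc1 hb1n (Or.inl (by linarith)) hc2
    (Or.inl (by linarith)) hc2p
  obtain ⟨rfl, -⟩ := h.noDown _ _ _ _ hd2 hk2 b1 c1 hc1 (Or.inl (by linarith)) (Or.inl (by linarith))
  linarith

end LocalFan
end

/-! ### Planar drawings in which every inner vertex has a flat corner -/

section
open FaceSystem
open scoped Classical

theorem lexNeg_of_opposite {α β γ δ x y x' y' s t : ℝ} (hs : 0 < s) (ht : 0 < t)
    (hx : s * x = - (t * x')) (hy : s * y = - (t * y')) (h : LexPos α β γ δ x' y') :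
    LexNeg α β γ δ x y := by
  have e1 : s * (α * x + β * y) = - (t * (α * x' + β * y')) := by linear_combination α * hx + β * hy
  have e2 : s * (γ * x + δ * y) = - (t * (γ * x' + δ * y')) := by linear_combination γ * hx + δ * hy
  rcases h with h | ⟨h, h'⟩
  · left
    have := mul_pos ht h
    by_contra hc
    have := mul_nonneg hs.le (not_lt.1 hc)
    linarith
  · right
    have h1 := mul_pos ht h'
    rw [h, mul_zero, neg_zero] at e1
    refine ⟨(mul_eq_zero.1 e1).resolve_left hs.ne', ?_⟩
    by_contra hc
    have := mul_nonneg hs.le (not_lt.1 hc)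
    linarith

theorem lexPos_of_opposite {α β γ δ x y x' y' s t : ℝ} (hs : 0 < s) (ht : 0 < t)
    (hx : s * x = - (t * x')) (hy : s * y = - (t * y')) (h : LexNeg α β γ δ x' y') :
    LexPos α β γ δ x y := by
  have h' : LexPos α β γ δ (-x') (-y') := by
    rcases h with h | ⟨h, h'⟩
    · left; linarith
    · right; constructor <;> linarith
  have := lexNeg_of_opposite (x := -x) (y := -y) hs ht (by linarith) (by linarith) h'
  rcases this with h | ⟨h, h'⟩
  · left; linarith
  · right; constructor <;> linarith

theorem exists_opposite {x y x' y' : ℝ} (hc : x * y' - y * x' = 0) (h : LexNeg 1 0 0 1 x y)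
    (h' : LexPos 1 0 0 1 x' y') :
    ∃ s t : ℝ, 0 < s ∧ 0 < t ∧ s * x = - (t * x') ∧ s * y = - (t * y') := by
  simp only [LexPos, LexNeg, one_mul, zero_mul, add_zero, zero_add] at h h'
  rcases h' with h' | ⟨rfl, h'⟩
  · rcases h with h | ⟨rfl, h⟩
    · exact ⟨x', -x, h', by linarith, by ring, by linarith⟩
    · exfalso
      have := mul_neg_of_neg_of_pos h h'
      linarith
  · have hx : x = 0 := by
      have : x * y' = 0 := by linarith
      exact (mul_eq_zero.1 this).resolve_right h'.ne'
    subst hx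
    rcases h with h | ⟨-, h⟩
    · exact absurd h (lt_irrefl _)
    · exact ⟨y', -y, h', by linarith, by ring, by ring⟩

section
variable {V : Type*}

/-- Twice the signed area of the triangle with vertices `a`, `b`, `c` in the plane. -/
def planeArea (X Y : V → ℝ) (a b c : V) : ℝ :=
  (X b - X a) * (Y c - Y a) - (Y b - Y a) * (X c - X a)

theorem planeArea_rotate (X Y : V → ℝ) (a b c : V) :
    planeArea X Y b c a = planeArea X Y a b c := by
  unfold planeArea; ring

/-- A lexicographic order on the points of the plane. -/
def lexFun (X Y : V → ℝ) (α β γ δ : ℝ) (u : V) : ℝ ×ₗ ℝ :=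
  toLex (α * X u + β * Y u, γ * X u + δ * Y u)

theorem lexFun_lt_iff {X Y : V → ℝ} {α β γ δ : ℝ} {u v : V} :
    lexFun X Y α β γ δ v < lexFun X Y α β γ δ u ↔ LexPos α β γ δ (X u - X v) (Y u - Y v) := by
  simp only [lexFun, Prod.Lex.toLex_lt_toLex, LexPos]
  have e1 : α * (X u - X v) + β * (Y u - Y v) = (α * X u + β * Y u) - (α * X v + β * Y v) := by ring
  have e2 : γ * (X u - X v) + δ * (Y u - Y v) = (γ * X u + δ * Y u) - (γ * X v + δ * Y v) := by ring
  rw [e1, e2, sub_pos, sub_pos, sub_eq_zero, eq_comm (a := α * X u + β * Y u)]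

theorem lexFun_gt_iff {X Y : V → ℝ} {α β γ δ : ℝ} {u v : V} :
    lexFun X Y α β γ δ u < lexFun X Y α β γ δ v ↔ LexNeg α β γ δ (X u - X v) (Y u - Y v) := by
  rw [lexFun_lt_iff]
  simp only [LexPos, LexNeg]
  have e1 : α * (X v - X u) + β * (Y v - Y u) = -(α * (X u - X v) + β * (Y u - Y v)) := by ring
  have e2 : γ * (X v - X u) + δ * (Y v - Y u) = -(γ * (X u - X v) + δ * (Y u - Y v)) := by ring
  rw [e1, e2, neg_pos, neg_pos, neg_eq_zero]

/-- A drawing in the plane of a triangulated sphere, whose outer face is `n0 n1 n2`, and in which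
every other vertex lies between its two neighbours in one of its faces. -/
structure FlatSystem [Fintype V] (F : V → V → V → Prop) (X Y : V → ℝ) (n0 n1 n2 : V) : Prop where
  faces : FaceSystem F
  card : (triples F).card + 12 = 6 * Fintype.card V
  inj : ∀ u v, X u = X v → Y u = Y v → u = v
  outer : F n0 n1 n2
  outer_neg : planeArea X Y n0 n1 n2 < 0
  flat : ∀ v, v ≠ n0 → v ≠ n1 → v ≠ n2 → ∃ k i, F v k i ∧ ∃ s t : ℝ, 0 < s ∧ 0 < t ∧
    s * (X i - X v) = - (t * (X k - X v)) ∧ s * (Y i - Y v) = - (t * (Y k - Y v))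

namespace FlatSystem

variable [Fintype V] {F : V → V → V → Prop} {X Y : V → ℝ} {n0 n1 n2 : V}

theorem rotate (h : FlatSystem F X Y n0 n1 n2) : FlatSystem F X Y n1 n2 n0 where
  faces := h.faces
  card := h.card
  inj := h.inj
  outer := h.faces.rotate h.outer
  outer_neg := by rw [planeArea_rotate]; exact h.outer_neg
  flat v h1 h2 h0 := h.flat v h0 h1 h2

theorem lexFun_injective (h : FlatSystem F X Y n0 n1 n2) {α β γ δ : ℝ} (hd : α * δ - β * γ ≠ 0) :
    Function.Injective (lexFun X Y α β γ δ) := by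
  intro u v huv
  by_contra hne
  have h0 : X u - X v ≠ 0 ∨ Y u - Y v ≠ 0 := by
    by_contra hcon
    push Not at hcon
    exact hne (h.inj u v (by linarith [hcon.1]) (by linarith [hcon.2]))
  by_cases hp : LexPos α β γ δ (X u - X v) (Y u - Y v)
  · exact (lexFun_lt_iff.2 hp).ne' huv
  · exact (lexFun_gt_iff.2 (lexNeg_of_not_lexPos hd h0 hp)).ne huv

/-- The vertex lies strictly between the two neighbours at its flat corner, and every order puts
these on different sides of it. -/
theorem crossed (h : FlatSystem F X Y n0 n1 n2) {α β γ δ : ℝ} (hd : α * δ - β * γ ≠ 0) {v : V}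
    (h0 : v ≠ n0) (h1 : v ≠ n1) (h2 : v ≠ n2) :
    ∃ i k, F v i k ∧
      ((lexFun X Y α β γ δ i < lexFun X Y α β γ δ v ∧ lexFun X Y α β γ δ v < lexFun X Y α β γ δ k) ∨
       (lexFun X Y α β γ δ v < lexFun X Y α β γ δ i ∧ lexFun X Y α β γ δ k < lexFun X Y α β γ δ v)) := by
  obtain ⟨k, i, hf, s, t, hs, ht, hx, hy⟩ := h.flat v h0 h1 h2
  refine ⟨k, i, hf, ?_⟩
  rcases ((h.lexFun_injective hd).ne (h.faces.ne hf)).lt_or_gt with hlt | hlt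
  · exact Or.inr ⟨hlt, lexFun_gt_iff.2 (lexNeg_of_opposite hs ht hx hy (lexFun_lt_iff.1 hlt))⟩
  · exact Or.inl ⟨hlt, lexFun_lt_iff.2 (lexPos_of_opposite hs ht hx hy (lexFun_gt_iff.1 hlt))⟩

theorem card_up_of_mid (h : FlatSystem F X Y n0 n1 n2) {α β γ δ : ℝ} (hd : α * δ - β * γ ≠ 0)
    (hmid : (lexFun X Y α β γ δ n1 < lexFun X Y α β γ δ n0 ∧
        lexFun X Y α β γ δ n0 < lexFun X Y α β γ δ n2) ∨
      (lexFun X Y α β γ δ n0 < lexFun X Y α β γ δ n1 ∧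
        lexFun X Y α β γ δ n2 < lexFun X Y α β γ δ n0)) (v : V) :
    (up F (lexFun X Y α β γ δ) v).card = if v = n1 ∨ v = n2 then 0 else 1 :=
  h.faces.card_up_eq (h.lexFun_injective hd) h.card h.outer hmid
    (fun _ h0 h1 h2 => h.crossed hd h0 h1 h2) v

/-- In any order one of the outer vertices is the middle one; the outer face is rotated to put it
first. -/
theorem card_up (h : FlatSystem F X Y n0 n1 n2) {α β γ δ : ℝ} (hd : α * δ - β * γ ≠ 0) {v : V}
    (h0 : v ≠ n0) (h1 : v ≠ n1) (h2 : v ≠ n2) : (up F (lexFun X Y α β γ δ) v).card = 1 := by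
  have i := h.lexFun_injective hd
  have e1 := i.ne (h.faces.ne h.outer)
  have e2 := i.ne (h.faces.ne h.rotate.outer)
  have e3 := i.ne (h.faces.ne h.rotate.rotate.outer)
  have c0 := h.card_up_of_mid hd (v := v)
  have c1 := h.rotate.card_up_of_mid hd (v := v)
  have c2 := h.rotate.rotate.card_up_of_mid hd (v := v)
  simp only [h0, h1, h2, or_self, if_false] at c0 c1 c2
  rcases e1.lt_or_gt with e1 | e1 <;> rcases e2.lt_or_gt with e2 | e2 <;>
    rcases e3.lt_or_gt with e3 | e3 <;>
    first
    | exact c0 (Or.inl ⟨e1, e3⟩)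
    | exact c0 (Or.inr ⟨e1, e3⟩)
    | exact c1 (Or.inl ⟨e2, e1⟩)
    | exact c1 (Or.inr ⟨e2, e1⟩)
    | exact c2 (Or.inl ⟨e3, e2⟩)
    | exact c2 (Or.inr ⟨e3, e2⟩)

/-- An outer vertex that is first among the outer vertices is first among all vertices. -/
theorem le_of_outer_le (h : FlatSystem F X Y n0 n1 n2) {α β γ δ : ℝ} (hd : α * δ - β * γ ≠ 0)
    (h1 : lexFun X Y α β γ δ n0 < lexFun X Y α β γ δ n1)
    (h2 : lexFun X Y α β γ δ n0 < lexFun X Y α β γ δ n2) (u : V) :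
    lexFun X Y α β γ δ n0 ≤ lexFun X Y α β γ δ u := by
  obtain ⟨v, -, hv⟩ := Finset.exists_min_image Finset.univ (lexFun X Y α β γ δ) ⟨n0, Finset.mem_univ _⟩
  have hv' : v = n0 := by
    by_contra h0
    by_cases e1 : v = n1
    · exact absurd h1 (not_lt.2 (e1 ▸ hv n0 (Finset.mem_univ _)))
    by_cases e2 : v = n2
    · exact absurd h2 (not_lt.2 (e2 ▸ hv n0 (Finset.mem_univ _)))
    obtain ⟨i, k, -, ⟨hc, -⟩ | ⟨-, hc⟩⟩ := h.crossed hd h0 e1 e2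
    · exact absurd hc (not_lt.2 (hv i (Finset.mem_univ _)))
    · exact absurd hc (not_lt.2 (hv k (Finset.mem_univ _)))
  exact hv' ▸ hv u (Finset.mem_univ _)

/-- The inner faces at an outer vertex are not negatively oriented. -/
theorem outer_corner (h : FlatSystem F X Y n0 n1 n2) {b c : V} (hf : F n0 b c)
    (hn : planeArea X Y n0 b c < 0) : b = n1 ∧ c = n2 := by
  -- All vertices lie in the closed angle of the outer triangle at `n0`: in the two orders given by
  -- the sides of this angle, `n0` comes first among the outer vertices.
  have wedge : ∀ u, 0 ≤ planeArea X Y n0 n2 u ∧ 0 ≤ planeArea X Y n0 u n1 := by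
    intro u
    have hN := h.outer_neg
    simp only [planeArea] at hN ⊢
    have z1 : X n1 - X n0 ≠ 0 ∨ Y n1 - Y n0 ≠ 0 := by
      by_contra hcon; push Not at hcon; rw [hcon.1, hcon.2] at hN; linarith
    have z2 : X n2 - X n0 ≠ 0 ∨ Y n2 - Y n0 ≠ 0 := by
      by_contra hcon; push Not at hcon; rw [hcon.1, hcon.2] at hN; linarith
    have z1 := sq_add_sq_pos z1
    have z2 := sq_add_sq_pos z2
    constructor
    · by_contra hcon
      have := h.le_of_outer_le (α := -(Y n2 - Y n0)) (β := X n2 - X n0) (γ := X n2 - X n0)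
        (δ := Y n2 - Y n0) (by linarith) (lexFun_lt_iff.2 (Or.inl (by linarith)))
        (lexFun_lt_iff.2 (Or.inr ⟨by ring, by linarith⟩)) u
      exact absurd (lexFun_gt_iff.2 (Or.inl (by linarith))) (not_lt.2 this)
    · by_contra hcon
      have := h.le_of_outer_le (α := Y n1 - Y n0) (β := -(X n1 - X n0)) (γ := X n1 - X n0)
        (δ := Y n1 - Y n0) (by linarith)
        (lexFun_lt_iff.2 (Or.inr ⟨by ring, by linarith⟩))
        (lexFun_lt_iff.2 (Or.inl (by linarith))) u
      exact absurd (lexFun_gt_iff.2 (Or.inl (by linarith))) (not_lt.2 this)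
  obtain ⟨wb2, wb1⟩ := wedge b
  obtain ⟨wc2, wc1⟩ := wedge c
  have hN := h.outer_neg
  simp only [planeArea] at hN hn wb1 wb2 wc1 wc2
  set x1 := X n1 - X n0
  set y1 := Y n1 - Y n0
  set x2 := X n2 - X n0
  set y2 := Y n2 - Y n0
  set xb := X b - X n0 with hxb
  set yb := Y b - Y n0 with hyb
  set xc := X c - X n0 with hxc
  set yc := Y c - Y n0 with hyc
  have hm0 : 0 < (xb + xc) * (xb + xc) + (yb + yc) * (yb + yc) := by
    apply sq_add_sq_pos
    by_contra hcon
    push Not at hcon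
    have h1 : yc = - yb := by linarith [hcon.2]
    have h2 : xc = - xb := by linarith [hcon.1]
    rw [h1, h2] at hn
    linarith
  have s1 : 0 < (xb + xc) * y1 - (yb + yc) * x1 := by
    by_contra hcon
    have z1 : xb * y1 - yb * x1 = 0 := by linarith
    have z2 : xc * y1 - yc * x1 = 0 := by linarith
    have : (x1 * x1 + y1 * y1) * (xb * yc - yb * xc) = 0 := by
      linear_combination (x1 * xc + y1 * yc) * z1 - (x1 * xb + y1 * yb) * z2
    have hp : 0 < x1 * x1 + y1 * y1 := by
      apply sq_add_sq_pos
      by_contra hcon; push Not at hcon; rw [hcon.1, hcon.2] at hN; linarith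
    rcases mul_eq_zero.1 this with h | h <;> linarith
  have s2 : 0 < x2 * (yb + yc) - y2 * (xb + xc) := by
    by_contra hcon
    have z1 : x2 * yb - y2 * xb = 0 := by linarith
    have z2 : x2 * yc - y2 * xc = 0 := by linarith
    have : (x2 * x2 + y2 * y2) * (xb * yc - yb * xc) = 0 := by
      linear_combination (x2 * xb + y2 * yb) * z2 - (x2 * xc + y2 * yc) * z1
    have hp : 0 < x2 * x2 + y2 * y2 := by
      apply sq_add_sq_pos
      by_contra hcon; push Not at hcon; rw [hcon.1, hcon.2] at hN; linarith
    rcases mul_eq_zero.1 this with h | h <;> linarith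
  -- The line through `n0` in the direction of the sum of the vectors to `b` and `c` lies inside the
  -- angle. It separates `n1` from `n2` and `b` from `c`, so both corners are up-corners, of which
  -- `n0` has only one.
  have hd : (yb + yc) * (yb + yc) - (-(xb + xc)) * (xb + xc) ≠ 0 := by linarith
  have p1 := lexFun_gt_iff (X := X) (Y := Y) (α := yb + yc) (β := -(xb + xc)) (γ := xb + xc)
    (δ := yb + yc) (u := n1) (v := n0) |>.2 (Or.inl (by linarith))
  have p2 := lexFun_lt_iff (X := X) (Y := Y) (α := yb + yc) (β := -(xb + xc)) (γ := xb + xc)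
    (δ := yb + yc) (u := n2) (v := n0) |>.2 (Or.inl (by linarith))
  have p3 := lexFun_gt_iff (X := X) (Y := Y) (α := yb + yc) (β := -(xb + xc)) (γ := xb + xc)
    (δ := yb + yc) (u := b) (v := n0) |>.2 (Or.inl (by rw [← hxb, ← hyb]; linarith))
  have p4 := lexFun_lt_iff (X := X) (Y := Y) (α := yb + yc) (β := -(xb + xc)) (γ := xb + xc)
    (δ := yb + yc) (u := c) (v := n0) |>.2 (Or.inl (by rw [← hxc, ← hyc]; linarith))
  have hc := h.card_up_of_mid hd (Or.inl ⟨p1, p2⟩) n0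
  rw [if_neg (by
    rintro (e | e)
    · exact h.faces.ne h.outer e
    · exact h.faces.ne h.rotate.rotate.outer e.symm)] at hc
  have := Finset.card_le_one.1 hc.le (b, c) (mem_up.2 ⟨hf, p3, p4⟩) (n1, n2)
    (mem_up.2 ⟨h.outer, p1, p2⟩)
  exact ⟨congrArg Prod.fst this, congrArg Prod.snd this⟩

/-- The fan of neighbours of an inner vertex. -/
theorem localFan (h : FlatSystem F X Y n0 n1 n2) {v : V}
    (h0 : v ≠ n0) (h1 : v ≠ n1) (h2 : v ≠ n2) {k i : V} (hki : F v k i) {s t : ℝ} (hs : 0 < s)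
    (ht : 0 < t) (hx : s * (X i - X v) = - (t * (X k - X v)))
    (hy : s * (Y i - Y v) = - (t * (Y k - Y v))) :
    LocalFan (fun u => X u - X v) (fun u => Y u - Y v) (F v) k i where
  ne_zero b c hf := by
    have key : ∀ u, v ≠ u → X u - X v ≠ 0 ∨ Y u - Y v ≠ 0 := by
      intro u hu
      by_contra hcon
      push Not at hcon
      exact hu (h.inj v u (by linarith [hcon.1]) (by linarith [hcon.2]))
    exact ⟨key b (h.faces.ne hf), key c (h.faces.ne (h.faces.rotate (h.faces.rotate hf))).symm⟩
  corner := hki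
  flat := by
    have : s * ((X k - X v) * (Y i - Y v) - (Y k - Y v) * (X i - X v)) = 0 := by
      linear_combination (X k - X v) * hy - (Y k - Y v) * hx
    exact (mul_eq_zero.1 this).resolve_left hs.ne'
  noDown α β γ δ hd hk b c hf hb hc := by
    have hcard := h.card_up hd h0 h1 h2
    rw [← h.faces.card_down (h.lexFun_injective hd)] at hcard
    have := Finset.card_le_one.1 hcard.le (b, c)
      (mem_down.2 ⟨hf, lexFun_lt_iff.2 hb, lexFun_gt_iff.2 hc⟩) (k, i)
      (mem_down.2 ⟨hki, lexFun_lt_iff.2 hk, lexFun_gt_iff.2 (lexNeg_of_opposite hs ht hx hy hk)⟩)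
    exact ⟨congrArg Prod.fst this, congrArg Prod.snd this⟩
  upUnique α β γ δ hd _ b c b' c' hf hb hc hf' hb' hc' := by
    have := Finset.card_le_one.1 (h.card_up hd h0 h1 h2).le (b, c)
      (mem_up.2 ⟨hf, lexFun_gt_iff.2 hb, lexFun_lt_iff.2 hc⟩) (b', c')
      (mem_up.2 ⟨hf', lexFun_gt_iff.2 hb', lexFun_lt_iff.2 hc'⟩)
    exact ⟨congrArg Prod.fst this, congrArg Prod.snd this⟩
  enter W hW := h.faces.exists_enter W hW

/-- All inner faces are nonnegatively oriented. -/
theorem planeArea_nonneg (h : FlatSystem F X Y n0 n1 n2) {a b c : V} (hf : F a b c)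
    (hno : ¬ ((a = n0 ∨ a = n1 ∨ a = n2) ∧ (b = n0 ∨ b = n1 ∨ b = n2) ∧
      (c = n0 ∨ c = n1 ∨ c = n2))) : 0 ≤ planeArea X Y a b c := by
  by_contra hneg
  rw [not_le] at hneg
  set N : V → Prop := fun v => v = n0 ∨ v = n1 ∨ v = n2 with hN
  set P : V → Prop := fun v => ∃ b c, F v b c ∧ planeArea X Y v b c < 0 ∧ ¬ (N v ∧ N b ∧ N c) with hP
  -- Extremal choice: `v` is the last vertex that belongs to a negatively oriented inner face.
  obtain ⟨v, hv, hmax⟩ := Finset.exists_max_image (Finset.univ.filter P) (lexFun X Y 1 0 0 1)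
    ⟨a, by simp only [Finset.mem_filter, Finset.mem_univ, true_and]; exact ⟨b, c, hf, hneg, hno⟩⟩
  simp only [Finset.mem_filter, Finset.mem_univ, true_and] at hv hmax
  have hPrs : ∀ {u b c}, F u b c → planeArea X Y u b c < 0 → ¬ (N u ∧ N b ∧ N c) → P b ∧ P c := by
    intro u b c hf hn hno
    exact ⟨⟨c, u, h.faces.rotate hf, by rwa [planeArea_rotate],
        fun h' => hno ⟨h'.2.2, h'.1, h'.2.1⟩⟩,
      ⟨u, b, h.faces.rotate (h.faces.rotate hf), by rwa [planeArea_rotate, planeArea_rotate],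
        fun h' => hno ⟨h'.2.1, h'.2.2, h'.1⟩⟩⟩
  obtain ⟨b', c', hf', hn', hno'⟩ := hv
  have h0 : v ≠ n0 := by
    rintro rfl
    obtain ⟨rfl, rfl⟩ := h.outer_corner hf' hn'
    exact hno' ⟨Or.inl rfl, Or.inr (Or.inl rfl), Or.inr (Or.inr rfl)⟩
  have h1 : v ≠ n1 := by
    rintro rfl
    obtain ⟨rfl, rfl⟩ := h.rotate.outer_corner hf' hn'
    exact hno' ⟨Or.inr (Or.inl rfl), Or.inr (Or.inr rfl), Or.inl rfl⟩
  have h2 : v ≠ n2 := by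
    rintro rfl
    obtain ⟨rfl, rfl⟩ := h.rotate.rotate.outer_corner hf' hn'
    exact hno' ⟨Or.inr (Or.inr rfl), Or.inl rfl, Or.inr (Or.inl rfl)⟩
  have hnv : ¬ N v := by rintro (e | e | e); exacts [h0 e, h1 e, h2 e]
  obtain ⟨k, i, hki, s, t, hs, ht, hx, hy⟩ := h.flat v h0 h1 h2
  have hfan := h.localFan h0 h1 h2 hki hs ht hx hy
  have hd : (1 : ℝ) * 1 - 0 * 0 ≠ 0 := by norm_num
  -- There is one up-corner and one down-corner at `v`. The flat corner is one of them, and `b c` is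
  -- the other.
  have hcr : ∃ b c, F v b c ∧ b ≠ k ∧
      ((lexFun X Y 1 0 0 1 b < lexFun X Y 1 0 0 1 v ∧ lexFun X Y 1 0 0 1 v < lexFun X Y 1 0 0 1 c) ∨
       (lexFun X Y 1 0 0 1 v < lexFun X Y 1 0 0 1 b ∧ lexFun X Y 1 0 0 1 c < lexFun X Y 1 0 0 1 v)) := by
    have hu := h.card_up hd h0 h1 h2
    have hdn := hu
    rw [← h.faces.card_down (h.lexFun_injective hd)] at hdn
    rcases ((h.lexFun_injective hd).ne (h.faces.ne hki)).lt_or_gt with hlt | hlt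
    · obtain ⟨x, hxu⟩ := Finset.card_pos.1 (hu ▸ one_pos)
      obtain ⟨m1, m2, m3⟩ := mem_up.1 hxu
      exact ⟨x.1, x.2, m1, fun e => (e ▸ m2).not_gt hlt, Or.inl ⟨m2, m3⟩⟩
    · obtain ⟨x, hxu⟩ := Finset.card_pos.1 (hdn ▸ one_pos)
      obtain ⟨m1, m2, m3⟩ := mem_down.1 hxu
      exact ⟨x.1, x.2, m1, fun e => (e ▸ m2).not_gt hlt, Or.inr ⟨m2, m3⟩⟩
  obtain ⟨b, c, hbc, hbk, hcross⟩ := hcr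
  -- If `b c` is negative, one of `b`, `c` comes after `v`, against the choice of `v`. If it is
  -- degenerate, it is a second flat corner. If it is positive, it conflicts with the negative
  -- corner `b' c'` in the fan.
  rcases lt_trichotomy (planeArea X Y v b c) 0 with hs' | hs' | hs'
  · obtain ⟨pb, pc⟩ := hPrs hbc hs' (fun h' => hnv h'.1)
    rcases hcross with ⟨-, hc⟩ | ⟨hc, -⟩
    · exact absurd hc (not_lt.2 (hmax _ pc))
    · exact absurd hc (not_lt.2 (hmax _ pb))
  · have hopp : ∃ s t : ℝ, 0 < s ∧ 0 < t ∧ s * (X b - X v) = - (t * (X c - X v)) ∧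
        s * (Y b - Y v) = - (t * (Y c - Y v)) := by
      rcases hcross with ⟨m1, m2⟩ | ⟨m1, m2⟩
      · exact exists_opposite hs' (lexFun_gt_iff.1 m1) (lexFun_lt_iff.1 m2)
      · obtain ⟨s, t, hs, ht, e1, e2⟩ := exists_opposite (x := X c - X v) (y := Y c - Y v)
          (x' := X b - X v) (y' := Y b - Y v) (by simp only [planeArea] at hs'; linarith)
          (lexFun_gt_iff.1 m2) (lexFun_lt_iff.1 m1)
        exact ⟨t, s, ht, hs, by linarith, by linarith⟩
    obtain ⟨s', t', hs1, ht1, hx1, hy1⟩ := hopp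
    have hn := hn'
    simp only [planeArea] at hn
    set xb := X b' - X v with hxb
    set yb := Y b' - Y v with hyb
    set xc := X c' - X v with hxc
    set yc := Y c' - Y v with hyc
    have hm0 : 0 < (xb + xc) * (xb + xc) + (yb + yc) * (yb + yc) := by
      apply sq_add_sq_pos
      by_contra hcon
      push Not at hcon
      have h1 : yc = - yb := by linarith [hcon.2]
      have h2 : xc = - xb := by linarith [hcon.1]
      rw [h1, h2] at hn
      linarith
    -- In this order the negative corner `b' c'` is the only up-corner. Both flat corners are then
    -- down-corners, but there is just one.
    have hd : (yb + yc) * (yb + yc) - (-(xb + xc)) * (xb + xc) ≠ 0 := by linarith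
    have p3 := lexFun_gt_iff (X := X) (Y := Y) (α := yb + yc) (β := -(xb + xc)) (γ := xb + xc)
      (δ := yb + yc) (u := b') (v := v) |>.2 (Or.inl (by rw [← hxb, ← hyb]; linarith))
    have p4 := lexFun_lt_iff (X := X) (Y := Y) (α := yb + yc) (β := -(xb + xc)) (γ := xb + xc)
      (δ := yb + yc) (u := c') (v := v) |>.2 (Or.inl (by rw [← hxc, ← hyc]; linarith))
    have hu := h.card_up hd h0 h1 h2
    have hdn := hu
    rw [← h.faces.card_down (h.lexFun_injective hd)] at hdn
    have key : ∀ {b c : V} {s t : ℝ}, F v b c → 0 < s → 0 < t →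
        s * (X b - X v) = - (t * (X c - X v)) → s * (Y b - Y v) = - (t * (Y c - Y v)) →
        (b, c) ∈ down F (lexFun X Y (yb + yc) (-(xb + xc)) (xb + xc) (yb + yc)) v := by
      intro b c s t hf hs ht hx hy
      rcases ((h.lexFun_injective hd).ne (h.faces.ne hf)).lt_or_gt with hlt | hlt
      · exact mem_down.2 ⟨hf, hlt, lexFun_gt_iff.2 (lexNeg_of_opposite ht hs (by linarith)
          (by linarith) (lexFun_lt_iff.1 hlt))⟩
      · exfalso
        have hm : (b, c) ∈ up F (lexFun X Y (yb + yc) (-(xb + xc)) (xb + xc) (yb + yc)) v :=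
          mem_up.2 ⟨hf, hlt, lexFun_lt_iff.2 (lexPos_of_opposite ht hs (by linarith)
            (by linarith) (lexFun_gt_iff.1 hlt))⟩
        have e := Finset.card_le_one.1 hu.le (b, c) hm (b', c') (mem_up.2 ⟨hf', p3, p4⟩)
        obtain ⟨rfl, rfl⟩ := Prod.mk.inj e
        have : s * (xb * yc - yb * xc) = 0 := by
          linear_combination (yc) * hx - (xc) * hy
        rcases mul_eq_zero.1 this with h | h <;> linarith
    have e := Finset.card_le_one.1 hdn.le (b, c) (key hbc hs1 ht1 hx1 hy1) (k, i)
      (key hki ht hs (by linarith) (by linarith))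
    exact hbk (congrArg Prod.fst e)
  · exact hfan.same_orientation hbc hs' hf' hn'

end FlatSystem
end
end

/-! ### The number of faces; down-faces and their apexes -/

section
open FaceSystem
open scoped Classical

/-- With the reversed orientation excluded by `hswap`, only the three rotations of one triangle
remain. -/
theorem FaceSystem.card_filter_eq_three {V : Type*} [Fintype V] {R : V → V → V → Prop}
    (hrot : ∀ {a b c}, R a b c → R b c a) (hne : ∀ {a b c}, R a b c → a ≠ b)
    (hswap : ∀ {a b c}, R a b c → ¬ R b a c) {a b c : V} (h : R a b c)
    (huniq : ∀ {i j k}, R i j k → i = a ∨ i = b ∨ i = c) :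
    (triples R).card = 3 := by
  have hab := hne h
  have hbc := hne (hrot h)
  have hca := hne (hrot (hrot h))
  have s1 := hswap h
  have s2 := hswap (hrot h)
  have s3 := hswap (hrot (hrot h))
  have e : triples R = {(a, b, c), (b, c, a), (c, a, b)} := by
    ext ⟨i, j, k⟩
    simp only [mem_triples, Finset.mem_insert, Finset.mem_singleton, Prod.mk.injEq]
    constructor
    · intro hR
      have nij := hne hR
      have njk := hne (hrot hR)
      have nki := hne (hrot (hrot hR))
      rcases huniq hR with rfl | rfl | rfl <;> rcases huniq (hrot hR) with rfl | rfl | rfl <;>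
        rcases huniq (hrot (hrot hR)) with rfl | rfl | rfl <;>
        simp_all only [ne_eq, not_true_eq_false, and_self, true_or, or_true]
    · rintro (⟨rfl, rfl, rfl⟩ | ⟨rfl, rfl, rfl⟩ | ⟨rfl, rfl, rfl⟩)
      · exact h
      · exact hrot h
      · exact hrot (hrot h)
  rw [e, Finset.card_eq_three]
  refine ⟨_, _, _, ?_, ?_, ?_, rfl⟩ <;> simp [Prod.mk.injEq] <;> tauto

variable {n : ℕ} {G : SimpleGraph (Fin n)} {p : Fin n → Fin 3 → ℝ}

namespace PolarTriangulation

theorem faceSystem (hP : PolarTriangulation G p) : FaceSystem (IsFace G p) where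
  rotate h := h.rotate
  ne h := h.1.ne
  unique h h' := hP.generic.left_face_unique hP.four_le h h'
  opposite h := hP.generic.exists_left_face hP.four_le h.1.symm

theorem pole_notMem (hP : PolarTriangulation G p) {q : Fin 3 → ℝ} (hu : q ∈ unitSphere)
    (hq : ∀ i j, i ≠ j → vol q (p i) (p j) ≠ 0) : q ∉ drawing G p := by
  rw [mem_drawing_iff hu]
  rintro (⟨i, c, -, rfl⟩ | ⟨i, j, hij, h⟩)
  · obtain ⟨k, hk, -⟩ := IsGenericTriangulation.exists_ne_ne hP.four_le i i
    apply hq i k hk.symm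
    simp only [vol_eq, Pi.smul_apply, smul_eq_mul]; ring
  · apply hq i j hij.ne
    rw [← vol_rotate]
    exact vol_eq_zero_of_mem_arcCone h

theorem exists_northFace (hP : PolarTriangulation G p) : ∃ i j k, IsNorthFace G p i j k := by
  have hu : northPole ∈ unitSphere := by simp [northPole, unitSphere]
  exact hP.generic.triangulated _ hu (hP.pole_notMem hu hP.generic.generic_pole)

theorem exists_southFace (hP : PolarTriangulation G p) : ∃ i j k, IsSouthFace G p i j k := by
  have hu : southPole ∈ unitSphere := by simp [southPole, unitSphere]
  refine hP.generic.triangulated _ hu (hP.pole_notMem hu fun i j hij h0 => ?_)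
  apply hP.generic.generic_pole i j hij
  have : vol northPole (p i) (p j) = - vol southPole (p i) (p j) := by
    simp [vol_eq, southPole, northPole]
  rw [this, h0, neg_zero]

theorem left_mem_of_northFace (hP : PolarTriangulation G p) {i j k i' j' k' : Fin n}
    (h : IsNorthFace G p i j k) (h' : IsNorthFace G p i' j' k') : i = i' ∨ i = j' ∨ i = k' :=
  hP.generic.left_mem_of_overlap h.1 h'.1 ⟨_, h.2.2, h'.2.2⟩

theorem left_mem_of_southFace (hP : PolarTriangulation G p) {i j k i' j' k' : Fin n}
    (h : IsSouthFace G p i j k) (h' : IsSouthFace G p i' j' k') : i = i' ∨ i = j' ∨ i = k' :=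
  hP.generic.left_mem_of_overlap h.1 h'.1 ⟨_, h.2.2, h'.2.2⟩

theorem card_northFace (hP : PolarTriangulation G p) : (triples (IsNorthFace G p)).card = 3 := by
  obtain ⟨a, b, c, h⟩ := hP.exists_northFace
  refine card_filter_eq_three (fun h => h.rotate) (fun h => h.1.1.ne) ?_ h
    (fun h' => hP.left_mem_of_northFace h' h)
  intro a b c h h'
  have h1 := ((hP.northFace_iff h.1).1 h).1
  have h2 := ((hP.northFace_iff h'.1).1 h').1
  rw [wedge_swap] at h2
  linarith

theorem card_southFace (hP : PolarTriangulation G p) : (triples (IsSouthFace G p)).card = 3 := by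
  obtain ⟨a, b, c, h⟩ := hP.exists_southFace
  refine card_filter_eq_three (fun h => h.rotate) (fun h => h.1.1.ne) ?_ h
    (fun h' => hP.left_mem_of_southFace h' h)
  intro a b c h h'
  have h1 := ((hP.southFace_iff h.1).1 h).1
  have h2 := ((hP.southFace_iff h'.1).1 h').1
  rw [wedge_swap] at h2
  linarith

theorem card_meridian_corners (hP : PolarTriangulation G p) {σ : ℝ} (hσ : σ ≠ 0) (a : Fin n) :
    ((corners (IsFace G p) a).filter fun x =>
      0 < σ * wedge (p x.2) (p a) ∧ 0 < σ * wedge (p a) (p x.1)).card = 1 := by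
  obtain ⟨i, k, hf, h1, h2⟩ := hP.exists_meridian_face a hσ
  rw [Finset.card_eq_one]
  refine ⟨(k, i), ?_⟩
  ext ⟨b, c⟩
  simp only [Finset.mem_filter, mem_corners, Finset.mem_singleton, Prod.mk.injEq]
  constructor
  · rintro ⟨hf', h1', h2'⟩
    obtain ⟨e1, e2⟩ := hP.meridian_face_unique hf h1 h2 hf'.rotate.rotate h1' h2'
    exact ⟨e2.symm, e1.symm⟩
  · rintro ⟨rfl, rfl⟩
    exact ⟨hf.rotate, h1, h2⟩

/-- The number of faces is `2n - 4`. -/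
theorem card_triples (hP : PolarTriangulation G p) :
    (triples (IsFace G p)).card + 12 = 6 * Fintype.card (Fin n) := by
  -- `g 1` and `g (-1)` mark the corners entered by the meridian going north and south from the
  -- first vertex. Each vertex has one of each, so the total is `2n`. A non-polar face has wedges of
  -- both signs and exactly one marked corner; a polar face has three. Summing over all rotations
  -- gives `3 * 2n` on one side and the number of triples plus `6 + 6` on the other.
  set g : ℝ → Fin n × Fin n × Fin n → ℕ := fun σ x =>
    if 0 < σ * wedge (p x.2.2) (p x.1) ∧ 0 < σ * wedge (p x.1) (p x.2.1) then 1 else 0 with hg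
  have h1 : ∀ σ : ℝ, σ ≠ 0 → ∑ x ∈ triples (IsFace G p), g σ x = n := by
    intro σ hσ
    rw [sum_triples]
    simp only [hg, ← Finset.card_filter, hP.card_meridian_corners hσ, Finset.sum_const,
      Finset.card_univ, Fintype.card_fin, smul_eq_mul, mul_one]
  have hN : ∑ x ∈ triples (IsFace G p), (if IsNorthFace G p x.1 x.2.1 x.2.2 then 1 else 0) = 3 := by
    rw [← Finset.card_filter, ← hP.card_northFace]
    congr 1
    ext x
    simp only [Finset.mem_filter, mem_triples]
    exact ⟨fun h => h.2, fun h => ⟨h.1, h⟩⟩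
  have hS : ∑ x ∈ triples (IsFace G p), (if IsSouthFace G p x.1 x.2.1 x.2.2 then 1 else 0) = 3 := by
    rw [← Finset.card_filter, ← hP.card_southFace]
    congr 1
    ext x
    simp only [Finset.mem_filter, mem_triples]
    exact ⟨fun h => h.2, fun h => ⟨h.1, h⟩⟩
  have h2 := hP.faceSystem.three_mul_sum_triples fun x => g 1 x + g (-1) x
  have h3 : ∑ x ∈ triples (IsFace G p), (g 1 x + g (-1) x
      + (g 1 (x.2.1, x.2.2, x.1) + g (-1) (x.2.1, x.2.2, x.1))
      + (g 1 (x.2.2, x.1, x.2.1) + g (-1) (x.2.2, x.1, x.2.1))) =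
      ∑ x ∈ triples (IsFace G p), (1 + 2 * (if IsNorthFace G p x.1 x.2.1 x.2.2 then 1 else 0)
        + 2 * (if IsSouthFace G p x.1 x.2.1 x.2.2 then 1 else 0)) := by
    refine Finset.sum_congr rfl ?_
    rintro ⟨a, b, c⟩ hx
    rw [mem_triples] at hx
    obtain ⟨n1, n2, n3⟩ := hP.wedge_ne hx
    simp only [hg, one_mul, neg_one_mul, neg_pos, hP.northFace_iff hx, hP.southFace_iff hx]
    rcases n1.lt_or_gt with h1 | h1 <;> rcases n2.lt_or_gt with h2 | h2 <;>
      rcases n3.lt_or_gt with h3 | h3 <;>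
      simp [h1, h2, h3, h1.not_gt, h2.not_gt, h3.not_gt]
  rw [h3, Finset.sum_add_distrib, Finset.sum_add_distrib, Finset.sum_add_distrib, ← Finset.mul_sum,
    ← Finset.mul_sum, hN, hS, h1 1 one_ne_zero, h1 (-1) (by norm_num), ← Finset.card_eq_sum_ones] at h2
  rw [Fintype.card_fin]
  omega

theorem northVertices_eq (hP : PolarTriangulation G p) {a b c : Fin n}
    (h : IsNorthFace G p a b c) : northVertices G p = {a, b, c} := by
  ext i
  simp only [northVertices, Set.mem_ofPred_eq, Set.mem_insert_iff, Set.mem_singleton_iff]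
  constructor
  · rintro ⟨j, k, h'⟩
    exact hP.left_mem_of_northFace h' h
  · rintro (rfl | rfl | rfl)
    · exact ⟨_, _, h⟩
    · exact ⟨_, _, h.rotate⟩
    · exact ⟨_, _, h.rotate.rotate⟩

end PolarTriangulation

/-- The non-polar face `i v k` is a down-face with apex `v`, western vertex `i` and eastern
vertex `k`. -/
def IsApex (G : SimpleGraph (Fin n)) (p : Fin n → Fin 3 → ℝ) (i v k : Fin n) : Prop :=
  IsFace G p i v k ∧ 0 < wedge (p i) (p v) ∧ 0 < wedge (p v) (p k) ∧ wedge (p k) (p i) < 0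

namespace PolarTriangulation

theorem nonPolar_of_apex (hP : PolarTriangulation G p) {i v k : Fin n} (h : IsApex G p i v k) :
    IsNonPolarFace G p i v k := by
  obtain ⟨hf, h1, h2, h3⟩ := h
  refine ⟨hf, ?_, ?_⟩
  · rw [hP.northFace_iff hf]; intro h; linarith [h.2.2]
  · rw [hP.southFace_iff hf]; intro h; linarith [h.1]

/-- The face just north of `v` qualifies, since a third positive wedge would make it the north face.
-/
theorem exists_apex (hP : PolarTriangulation G p) {v : Fin n} (hv : v ∉ northVertices G p) :
    ∃ i k, IsApex G p i v k := by
  obtain ⟨i, k, hf, h1, h2⟩ := hP.exists_meridian_face v one_ne_zero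
  rw [one_mul] at h1 h2
  refine ⟨i, k, hf, h1, h2, ?_⟩
  rcases (hP.wedge_ne hf).2.2.lt_or_gt with h3 | h3
  · exact h3
  · exact absurd ⟨k, i, ((hP.northFace_iff hf).2 ⟨h1, h2, h3⟩).rotate⟩ hv

theorem apex_unique (hP : PolarTriangulation G p) {i v k i' k' : Fin n} (h : IsApex G p i v k)
    (h' : IsApex G p i' v k') : i = i' ∧ k = k' :=
  hP.meridian_face_unique (σ := 1) h.1 (by linarith [h.2.1]) (by linarith [h.2.2.1]) h'.1
    (by linarith [h'.2.1]) (by linarith [h'.2.2.1])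

theorem notMem_northVertices_of_apex (hP : PolarTriangulation G p) {i v k : Fin n}
    (h : IsApex G p i v k) : v ∉ northVertices G p := by
  rintro ⟨j, l, hN⟩
  have hw := (hP.northFace_iff hN.1).1 hN
  obtain ⟨rfl, rfl⟩ := hP.meridian_face_unique (σ := 1) h.1 (by linarith [h.2.1])
    (by linarith [h.2.2.1]) hN.1.rotate.rotate (by linarith [hw.2.2]) (by linarith [hw.1])
  linarith [h.2.2.2, hw.2.1]

theorem apex_of_directlySouth (hP : PolarTriangulation G p) {i v k : Fin n}
    (hf : IsNonPolarFace G p v k i) (h : DirectlySouthOf (p v) (p k) (p i)) : IsApex G p i v k := by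
  obtain ⟨r, ⟨-, s, t, hs, ht, rfl⟩, c, hc, h0, h1, h2⟩ := h
  have hvol := hP.vol_pos hf
  obtain ⟨n1, n2, n3⟩ := hP.wedge_ne hf.1
  simp only [Pi.add_apply, Pi.smul_apply, smul_eq_mul] at h0 h1 h2
  -- Eliminating `r` expresses both wedges at `v` and the volume through the wedge of the opposite
  -- edge, whose sign is then fixed by the positive volume.
  have e1 : c * wedge (p v) (p k) = t * wedge (p i) (p k) := by
    unfold wedge; linear_combination (p k 0) * h1 - (p k 1) * h0
  have e2 : c * wedge (p i) (p v) = s * wedge (p i) (p k) := by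
    unfold wedge; linear_combination (p i 1) * h0 - (p i 0) * h1
  have e3 : c * vol (p v) (p k) (p i) = (s * p k 2 + t * p i 2 - c * p v 2) * wedge (p i) (p k) := by
    rw [vol_eq]; unfold wedge
    linear_combination (p k 2 * p i 1 - p k 1 * p i 2) * h0 + (p k 0 * p i 2 - p k 2 * p i 0) * h1
  have hik : 0 < wedge (p i) (p k) := by
    have h := mul_pos hc hvol
    rw [e3] at h
    exact (mul_pos_iff_of_pos_left (by linarith)).1 h
  refine ⟨hf.1.rotate.rotate, ?_, ?_, by rw [wedge_swap]; linarith⟩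
  · have h := mul_nonneg hs hik.le
    rw [← e2] at h
    exact lt_of_le_of_ne ((mul_nonneg_iff_of_pos_left hc).1 h) n3.symm
  · have h := mul_nonneg ht hik.le
    rw [← e1] at h
    exact lt_of_le_of_ne ((mul_nonneg_iff_of_pos_left hc).1 h) n1.symm

theorem directlySouth_of_apex (hP : PolarTriangulation G p) {i v k : Fin n}
    (h : IsApex G p i v k) : DirectlySouthOf (p v) (p k) (p i) := by
  have hvol := hP.vol_pos (hP.nonPolar_of_apex h)
  obtain ⟨hf, h1, h2, h3⟩ := h
  have hik : 0 < wedge (p i) (p k) := by rw [wedge_swap]; linarith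
  -- By the linear relation between three plane vectors, `q` is horizontally a positive multiple of
  -- `p v`; its extra height is the volume.
  set q := wedge (p i) (p v) • p k + wedge (p v) (p k) • p i with hq
  have q0 : q 0 = wedge (p i) (p k) * p v 0 := by
    simp only [hq, Pi.add_apply, Pi.smul_apply, smul_eq_mul, wedge]; ring
  have q1 : q 1 = wedge (p i) (p k) * p v 1 := by
    simp only [hq, Pi.add_apply, Pi.smul_apply, smul_eq_mul, wedge]; ring
  have q2 : q 2 = wedge (p i) (p k) * p v 2 + vol (p i) (p v) (p k) := by
    simp only [hq, Pi.add_apply, Pi.smul_apply, smul_eq_mul, wedge, vol_eq]; ring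
  have hq0 : q ≠ 0 := by
    intro h0
    rw [h0] at q0 q1
    simp only [Pi.zero_apply] at q0 q1
    have x0 : p v 0 = 0 := (mul_eq_zero.1 q0.symm).resolve_left hik.ne'
    have x1 : p v 1 = 0 := (mul_eq_zero.1 q1.symm).resolve_left hik.ne'
    simp only [wedge, x0, x1, mul_zero, sub_zero, lt_irrefl] at h1
  obtain ⟨r, hr, hu⟩ := exists_smul_mem_unitSphere hq0
  refine ⟨r • q, ⟨hu, r * wedge (p i) (p v), r * wedge (p v) (p k), by positivity, by positivity, ?_⟩,
    r * wedge (p i) (p k), by positivity, ?_, ?_, ?_⟩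
  · rw [hq, smul_add, smul_smul, smul_smul]
  · rw [Pi.smul_apply, smul_eq_mul, q0]; ring
  · rw [Pi.smul_apply, smul_eq_mul, q1]; ring
  · rw [Pi.smul_apply, smul_eq_mul, q2]
    have := mul_pos hr hvol
    linarith

theorem exists_apex_of_downFace (hP : PolarTriangulation G p) {i j k : Fin n}
    (h : IsDownFace G p i j k) : IsApex G p k i j ∨ IsApex G p i j k ∨ IsApex G p j k i := by
  obtain ⟨hf, h | h | h⟩ := h
  · exact Or.inl (hP.apex_of_directlySouth hf h)
  · exact Or.inr (Or.inl (hP.apex_of_directlySouth hf.rotate h))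
  · exact Or.inr (Or.inr (hP.apex_of_directlySouth hf.rotate.rotate h))

theorem downFace_of_apex (hP : PolarTriangulation G p) {i v k : Fin n} (h : IsApex G p i v k) :
    IsDownFace G p i v k :=
  ⟨hP.nonPolar_of_apex h, Or.inr (Or.inl (hP.directlySouth_of_apex h))⟩

theorem eq_of_apex_vertices {i v k i' v' k' : Fin n}
    (h : IsApex G p i v k) (h' : IsApex G p i' v' k')
    (he : ({i, v, k} : Finset (Fin n)) = {i', v', k'}) : v = v' := by
  have hv : v' = i ∨ v' = v ∨ v' = k := by
    have : v' ∈ ({i, v, k} : Finset (Fin n)) := by rw [he]; simp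
    simpa using this
  have hi : i' = i ∨ i' = v ∨ i' = k := by
    have : i' ∈ ({i, v, k} : Finset (Fin n)) := by rw [he]; simp
    simpa using this
  have hk : k' = i ∨ k' = v ∨ k' = k := by
    have : k' ∈ ({i, v, k} : Finset (Fin n)) := by rw [he]; simp
    simpa using this
  obtain ⟨hf, a1, a2, a3⟩ := h
  obtain ⟨hf', b1, b2, b3⟩ := h'
  have w1 := wedge_swap (p i) (p v)
  have w2 := wedge_swap (p v) (p k)
  have w3 := wedge_swap (p k) (p i)
  have z : ∀ a : Fin n, wedge (p a) (p a) = 0 := fun a => by unfold wedge; ring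
  rcases hv with rfl | rfl | rfl
  · rcases hi with rfl | rfl | rfl
    · linarith [z i']
    · linarith
    · linarith
  · rfl
  · rcases hk with rfl | rfl | rfl
    · linarith
    · linarith
    · linarith [z k']

/-- Sending a vertex outside the north face to the face just north of it is a bijection onto the
down-faces. -/
theorem ncard_downFaces (hP : PolarTriangulation G p) :
    (northVertices G p).ncard + (downFaces G p).ncard = n := by
  have hex : ∀ v : Fin n, v ∈ (northVertices G p)ᶜ → ∃ i k, IsApex G p i v k :=
    fun v hv => hP.exists_apex hv
  choose I K hIK using hex
  have key : ((northVertices G p)ᶜ).ncard = (downFaces G p).ncard := by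
    refine Set.ncard_congr (fun v hv => ({I v hv, v, K v hv} : Finset (Fin n))) ?_ ?_ ?_
    · intro v hv
      exact ⟨_, _, _, hP.downFace_of_apex (hIK v hv), rfl⟩
    · intro v v' hv hv' he
      exact eq_of_apex_vertices (hIK v hv) (hIK v' hv') he
    · have main : ∀ i v k, IsApex G p i v k → ∃ v' hv', ({I v' hv', v', K v' hv'} : Finset (Fin n)) =
          {i, v, k} := by
        intro i v k h
        have hv := hP.notMem_northVertices_of_apex h
        obtain ⟨e1, e2⟩ := hP.apex_unique (hIK v hv) h
        exact ⟨v, hv, by rw [e1, e2]⟩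
      rintro f ⟨i, j, k, h, rfl⟩
      rcases hP.exists_apex_of_downFace h with h | h | h
      · obtain ⟨v, hv, e⟩ := main _ _ _ h
        refine ⟨v, hv, e.trans ?_⟩
        ext; simp; tauto
      · exact main _ _ _ h
      · obtain ⟨v, hv, e⟩ := main _ _ _ h
        refine ⟨v, hv, e.trans ?_⟩
        ext; simp; tauto
  rw [← key, Set.ncard_add_ncard_compl, Nat.card_eq_fintype_card, Fintype.card_fin]

end PolarTriangulation
end

/-! ### Feasible heights are negative -/

section
open FaceSystem
open scoped Classical

variable {n : ℕ} {G : SimpleGraph (Fin n)} {p : Fin n → Fin 3 → ℝ}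

/-- The coefficients do not depend on the heights. In a down-face only the coefficient of the apex
is negative. -/
theorem vol'_eq (p : Fin n → Fin 3 → ℝ) (z : Fin n → ℝ) (i j k : Fin n) : vol' p z i j k =
    z i * wedge (p j) (p k) + z j * wedge (p k) (p i) + z k * wedge (p i) (p j) := by
  simp only [vol', vol_eq, wedge]
  simp
  ring

theorem vol'_rotate (p : Fin n → Fin 3 → ℝ) (z : Fin n → ℝ) (i j k : Fin n) :
    vol' p z j k i = vol' p z i j k := by
  rw [vol'_eq, vol'_eq]; ring

theorem vol_eq_vol' (p : Fin n → Fin 3 → ℝ) (i j k : Fin n) :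
    vol (p i) (p j) (p k) = vol' p (fun u => p u 2) i j k := by
  rw [vol'_eq, vol_eq]; unfold wedge; ring

/-- The height, up to the positive factor `wedge (p i) (p k)`, at which the meridian of `v` meets
the arc from `i` to `k`. -/
def meridianHeight (p : Fin n → Fin 3 → ℝ) (z : Fin n → ℝ) (v i k : Fin n) : ℝ :=
  wedge (p v) (p k) * z i + wedge (p i) (p v) * z k

namespace PolarTriangulation

/-- In the feasible region the drawing sinks below the equator. -/
theorem neg_of_feasible (hP : PolarTriangulation G p) {z : Fin n → ℝ} (hz : z ∈ sinkFeasible G p)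
    (v : Fin n) : z v < 0 := by
  obtain ⟨hzN, hzF⟩ := hz
  by_contra hv
  rw [not_lt] at hv
  have hvN : v ∉ northVertices G p := fun h => by linarith [hzN v h]
  obtain ⟨i0, k0, hD⟩ := hP.exists_apex hvN
  have hD0 := hP.vol_pos (hP.nonPolar_of_apex hD)
  have hD1 := hzF _ _ _ (hP.nonPolar_of_apex hD)
  obtain ⟨hDf, d1, d2, d3⟩ := hD
  rw [vol_eq_vol'] at hD0
  rw [vol'_eq] at hD0 hD1
  -- Edges, directed eastward, that cross the meridian of `v` at a nonnegative new height. The upper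
  -- edge of the down-face at `v` is one of them.
  set S : Finset (Fin n × Fin n) := Finset.univ.filter fun x =>
    G.Adj x.1 x.2 ∧ 0 < wedge (p x.1) (p v) ∧ 0 < wedge (p v) (p x.2) ∧
      0 < wedge (p x.1) (p x.2) ∧ 0 ≤ meridianHeight p z v x.1 x.2 with hS
  have hmem : ∀ i k, (i, k) ∈ S ↔ G.Adj i k ∧ 0 < wedge (p i) (p v) ∧ 0 < wedge (p v) (p k) ∧
      0 < wedge (p i) (p k) ∧ 0 ≤ meridianHeight p z v i k := by
    intro i k; simp [hS]
  have d3' : 0 < wedge (p i0) (p k0) := by rw [wedge_swap]; linarith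
  have h0 : (i0, k0) ∈ S := by
    refine (hmem _ _).2 ⟨hDf.2.2.1.symm, d1, d2, d3', ?_⟩
    have := mul_nonneg hv d3'.le
    rw [wedge_swap] at this
    unfold meridianHeight
    linarith
  -- Take the northernmost crossing in the original drawing. The quotient is the original height at
  -- the point of the edge's cone with the horizontal part of `p v`.
  obtain ⟨⟨i, k⟩, hik, hmax⟩ := Finset.exists_max_image S
    (fun x => meridianHeight p (fun u => p u 2) v x.1 x.2 / wedge (p x.1) (p x.2)) ⟨_, h0⟩
  rw [hmem] at hik
  obtain ⟨hadj, wi, wk, wik, hh⟩ := hik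
  -- The face north of this edge is not the north face, where all new heights are `-1`. Its two
  -- inequalities will produce an edge of `S` crossing still further north.
  obtain ⟨a, hf⟩ := hP.generic.exists_left_face hP.four_le hadj
  have hnN : ¬ IsNorthFace G p i k a := by
    intro hN
    have e1 := hzN i ⟨_, _, hN⟩
    have e2 := hzN k ⟨_, _, hN.rotate⟩
    unfold meridianHeight at hh
    rw [e1, e2] at hh
    linarith
  have hnS : ¬ IsSouthFace G p i k a := by
    rw [hP.southFace_iff hf]; intro h; linarith [h.1]
  have hF : IsNonPolarFace G p i k a := ⟨hf, hnN, hnS⟩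
  have hF0 := hP.vol_pos hF
  have hF1 := hzF _ _ _ hF
  rw [vol_eq_vol'] at hF0
  rw [vol'_eq] at hF0 hF1
  rw [hP.northFace_iff hf] at hnN
  have plucker : wedge (p v) (p k) * wedge (p a) (p i) =
      wedge (p v) (p i) * wedge (p a) (p k) - wedge (p v) (p a) * wedge (p i) (p k) := by
    unfold wedge; ring
  have s1 := wedge_swap (p v) (p i)
  have s2 := wedge_swap (p v) (p k)
  have s3 := wedge_swap (p v) (p a)
  have s4 := wedge_swap (p k) (p a)
  have s5 := wedge_swap (p i) (p a)
  have key : ∀ i' k', G.Adj i' k' → 0 < wedge (p i') (p v) → 0 < wedge (p v) (p k') →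
      0 < wedge (p i') (p k') →
      0 < wedge (p i) (p k) * meridianHeight p (fun u => p u 2) v i' k' -
        wedge (p i') (p k') * meridianHeight p (fun u => p u 2) v i k →
      0 ≤ wedge (p i) (p k) * meridianHeight p z v i' k' -
        wedge (p i') (p k') * meridianHeight p z v i k → False := by
    intro i' k' ha h1 h2 h3 h4 h5
    have hm : (i', k') ∈ S := by
      refine (hmem _ _).2 ⟨ha, h1, h2, h3, ?_⟩
      have := mul_nonneg h3.le hh
      exact (mul_nonneg_iff_of_pos_left wik).1 (by linarith)
    have := hmax _ hm
    rw [div_le_div_iff₀ h3 wik] at this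
    linarith
  -- If the third vertex is `v`, the edge passes south of `v` and the upper edge of the down-face at
  -- `v` is further north. Otherwise the edge from `a` to whichever of `i`, `k` lies across the
  -- meridian takes over.
  by_cases hav : a = v
  · subst hav
    have e : ∀ Z : Fin n → ℝ, wedge (p i) (p k) * meridianHeight p Z a i0 k0 -
        wedge (p i0) (p k0) * meridianHeight p Z a i k =
        wedge (p i) (p k) * (Z i0 * wedge (p a) (p k0) + Z a * wedge (p k0) (p i0)
          + Z k0 * wedge (p i0) (p a)) + wedge (p i0) (p k0) * (Z i * wedge (p k) (p a)
          + Z k * wedge (p a) (p i) + Z a * wedge (p i) (p k)) := by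
      intro Z; simp only [meridianHeight, wedge]; ring
    refine key i0 k0 hDf.2.2.1.symm d1 d2 d3' ?_ ?_
    · rw [e]; exact add_pos (mul_pos wik hD0) (mul_pos d3' hF0)
    · rw [e]; exact add_nonneg (mul_nonneg wik.le hD1) (mul_nonneg d3'.le hF1)
  · rcases (hP.generic.wedge_ne_zero hav).lt_or_gt with hw | hw
    · have hva : 0 < wedge (p v) (p a) := by linarith
      -- Otherwise the three wedges of the face are all positive, which makes it the north face, or
      -- their signs violate the Plücker relation.
      have hia : 0 < wedge (p i) (p a) := by
        by_contra hc
        have hai : 0 < wedge (p a) (p i) :=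
          lt_of_le_of_ne (by linarith) (hP.wedge_ne hf).2.2.symm
        have hka : wedge (p k) (p a) < 0 := by
          rcases (hP.wedge_ne hf).2.1.lt_or_gt with h | h
          · exact h
          · exact absurd ⟨wik, h, hai⟩ hnN
        have t1 := mul_pos wk hai
        have t2 := mul_pos hva wik
        have t3 := mul_pos wi (show 0 < wedge (p a) (p k) by linarith)
        nlinarith
      have e : ∀ Z : Fin n → ℝ, wedge (p i) (p k) * meridianHeight p Z v i a -
          wedge (p i) (p a) * meridianHeight p Z v i k = wedge (p i) (p v) *
          (Z i * wedge (p k) (p a) + Z k * wedge (p a) (p i) + Z a * wedge (p i) (p k)) := by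
        intro Z; simp only [meridianHeight, wedge]; ring
      refine key i a hf.2.2.1.symm wi hva hia ?_ ?_
      · rw [e]; exact mul_pos wi hF0
      · rw [e]; exact mul_nonneg wi.le hF1
    · have hak : 0 < wedge (p a) (p k) := by
        by_contra hc
        have hka : 0 < wedge (p k) (p a) :=
          lt_of_le_of_ne (by linarith) (hP.wedge_ne hf).2.1.symm
        have hai : wedge (p a) (p i) < 0 := by
          rcases (hP.wedge_ne hf).2.2.lt_or_gt with h | h
          · exact h
          · exact absurd ⟨wik, hka, h⟩ hnN
        have t1 := mul_pos wk (show 0 < - wedge (p a) (p i) by linarith)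
        have t2 := mul_pos hw wik
        have t3 := mul_pos wi hka
        nlinarith
      have e : ∀ Z : Fin n → ℝ, wedge (p i) (p k) * meridianHeight p Z v a k -
          wedge (p a) (p k) * meridianHeight p Z v i k = wedge (p v) (p k) *
          (Z i * wedge (p k) (p a) + Z k * wedge (p a) (p i) + Z a * wedge (p i) (p k)) := by
        intro Z; simp only [meridianHeight, wedge]; ring
      refine key a k hf.2.1.symm hw wk hak ?_ ?_
      · rw [e]; exact mul_pos wk hF0
      · rw [e]; exact mul_nonneg wk.le hF1

end PolarTriangulation
end

/-! ### Raising the heights until all down-faces are flat -/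

section
open FaceSystem
open scoped Classical

variable {n : ℕ} {G : SimpleGraph (Fin n)} {p : Fin n → Fin 3 → ℝ}

namespace PolarTriangulation

/-- A set of vertices that contains with each vertex `v` the upper edge of the down-face with
apex `v` is empty, if the down-faces admit a negative solution. -/
theorem not_closed (hP : PolarTriangulation G p) {z : Fin n → ℝ} (hneg : ∀ v, z v < 0)
    (hz : ∀ i v k, IsApex G p i v k → 0 ≤ vol' p z i v k) {Z : Fin n → Prop}
    (hN : ∀ v, Z v → v ∉ northVertices G p)
    (hZ : ∀ i v k, IsApex G p i v k → Z v → Z i ∧ Z k) (v : Fin n) : ¬ Z v := by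
  intro hv
  have hv0 : 0 < p v 0 * p v 0 + p v 1 * p v 1 := by
    obtain ⟨u, hu, -⟩ := IsGenericTriangulation.exists_ne_ne hP.four_le v v
    apply sq_add_sq_pos
    by_contra hcon
    push Not at hcon
    apply hP.generic.wedge_ne_zero hu
    simp [wedge, hcon.1, hcon.2]
  -- Adding a linear function of the horizontal coordinates leaves `vol'` unchanged; this multiple
  -- makes `g v` nonnegative.
  set c := |p v 2| / (p v 0 * p v 0 + p v 1 * p v 1) with hc
  set g : Fin n → ℝ := fun u => p u 2 + c * (p v 0 * p u 0 + p v 1 * p u 1) with hg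
  have hgv : 0 ≤ g v := by
    simp only [hg]
    rw [hc, div_mul_cancel₀ _ hv0.ne']
    linarith [neg_abs_le (p v 2)]
  have hgpos : ∀ i u k, IsApex G p i u k → 0 < vol' p g i u k := by
    intro i u k h
    have h1 := hP.vol_pos (hP.nonPolar_of_apex h)
    have e : vol' p g i u k = vol (p i) (p u) (p k) := by
      rw [vol'_eq, vol_eq]; simp only [hg, wedge]; ring
    rwa [e]
  -- Where the ratio attains its maximum `r ≥ 0`, comparison over the down-face with apex `u` gives
  -- `vol' p g ≤ -r * vol' p z ≤ 0`, against positivity for `g`.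
  obtain ⟨u, hu, hmax⟩ := Finset.exists_max_image (Finset.univ.filter Z) (fun u => g u / (- z u))
    ⟨v, by simpa using hv⟩
  simp only [Finset.mem_filter, Finset.mem_univ, true_and] at hu hmax
  obtain ⟨i, k, hA⟩ := hP.exists_apex (hN u hu)
  obtain ⟨hi, hk⟩ := hZ i u k hA hu
  have h1 := hgpos i u k hA
  have h2 := hz i u k hA
  obtain ⟨-, w1, w2, -⟩ := hA
  rw [vol'_eq] at h1 h2
  set r := g u / (- z u) with hr
  have hr0 : 0 ≤ r := le_trans (div_nonneg hgv (by linarith [hneg v])) (hmax v hv)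
  have gu : g u = r * (- z u) := by rw [hr, div_mul_cancel₀]; linarith [hneg u]
  have gi := (div_le_iff₀ (by linarith [hneg i])).1 (hmax i hi)
  have gk := (div_le_iff₀ (by linarith [hneg k])).1 (hmax k hk)
  have t1 := mul_le_mul_of_nonneg_right gi w2.le
  have t2 := mul_le_mul_of_nonneg_right gk w1.le
  have t3 := mul_nonneg hr0 h2
  rw [gu] at h1
  linarith

/-- Raising the vertices makes all down-faces flat. -/
theorem exists_flat (hP : PolarTriangulation G p) {z : Fin n → ℝ} (hz : z ∈ sinkFeasible G p) :
    ∃ y : Fin n → ℝ, z ≤ y ∧ (∀ v, y v < 0) ∧ (∀ v ∈ northVertices G p, y v = -1) ∧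
      ∀ i v k, IsApex G p i v k → vol' p y i v k = 0 := by
  have hneg := hP.neg_of_feasible hz
  have hzA : ∀ i v k, IsApex G p i v k → 0 ≤ vol' p z i v k :=
    fun i v k h => hz.2 _ _ _ (hP.nonPolar_of_apex h)
  -- Only the down-face constraints are kept; the upper bound `0` supplies compactness.
  set K : Set (Fin n → ℝ) := Set.Icc z 0 ∩ ({y | ∀ v ∈ northVertices G p, y v = -1} ∩
    {y | ∀ i v k, IsApex G p i v k → 0 ≤ vol' p y i v k}) with hK
  have hcomp : IsCompact K := by
    refine isCompact_Icc.inter_right (IsClosed.inter ?_ ?_)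
    · simp only [Set.ofPred_forall]
      exact isClosed_iInter fun v => isClosed_iInter fun _ =>
        isClosed_eq (continuous_apply v) continuous_const
    · simp only [Set.ofPred_forall]
      refine isClosed_iInter fun i => isClosed_iInter fun v => isClosed_iInter fun k =>
        isClosed_iInter fun _ => isClosed_le continuous_const ?_
      simp only [vol'_eq]
      fun_prop
  obtain ⟨y, ⟨⟨hzy, hy0⟩, hyN, hyA⟩, hmax⟩ := hcomp.exists_isMaxOn
    ⟨z, ⟨le_refl z, fun v => (hneg v).le⟩, hz.1, hzA⟩
    (f := fun y : Fin n → ℝ => ∑ v, y v) (by fun_prop)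
  have htight : ∀ i v k, IsApex G p i v k → vol' p y i v k = 0 := by
    intro i v k hA
    by_contra hne
    have hpos : 0 < vol' p y i v k := lt_of_le_of_ne (hyA i v k hA) (Ne.symm hne)
    have hA' := hA
    obtain ⟨hf, w1, w2, w3⟩ := hA'
    rw [vol'_eq] at hpos
    have hw : 0 < - wedge (p k) (p i) := by linarith
    -- The height of `v` that flattens its down-face. Moving `v` up to it does not decrease `vol'`
    -- on any other down-face.
    set t := (y i * wedge (p v) (p k) + y k * wedge (p i) (p v)) / (- wedge (p k) (p i)) with ht
    have ht' : t * (- wedge (p k) (p i)) = y i * wedge (p v) (p k) + y k * wedge (p i) (p v) := by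
      rw [ht, div_mul_cancel₀ _ hw.ne']
    have hty : y v < t := by
      rw [ht, lt_div_iff₀ hw]; linarith
    have ht0 : t ≤ 0 := by
      apply div_nonpos_of_nonpos_of_nonneg _ hw.le
      have := mul_nonpos_of_nonpos_of_nonneg (hy0 i) w2.le
      have := mul_nonpos_of_nonpos_of_nonneg (hy0 k) w1.le
      linarith
    set y' := Function.update y v t with hy'
    have hv' : y' v = t := by simp [hy']
    have hu' : ∀ u, u ≠ v → y' u = y u := by
      intro u hu; simp [hy', hu]
    have hle : ∀ u, y u ≤ y' u := by
      intro u
      by_cases h : u = v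
      · rw [h, hv']; exact hty.le
      · rw [hu' u h]
    have hmem : y' ∈ K := by
      refine ⟨⟨fun u => (hzy u).trans (hle u), ?_⟩, ?_, ?_⟩
      · intro u
        by_cases h : u = v
        · rw [h, hv']; exact ht0
        · rw [hu' u h]; exact hy0 u
      · intro u hu
        rw [hu' u (fun h => hP.notMem_northVertices_of_apex hA (h ▸ hu))]
        exact hyN u hu
      · intro a u b hA2
        by_cases h : u = v
        · subst h
          obtain ⟨rfl, rfl⟩ := hP.apex_unique hA hA2
          rw [vol'_eq, hv', hu' _ hf.1.ne, hu' _ hf.2.1.ne.symm]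
          linarith
        · have h1 := hyA a u b hA2
          obtain ⟨-, v1, v2, -⟩ := hA2
          rw [vol'_eq] at h1 ⊢
          rw [hu' u h]
          have := mul_le_mul_of_nonneg_right (hle a) v2.le
          have := mul_le_mul_of_nonneg_right (hle b) v1.le
          linarith
    have hlt : ∑ u, y u < ∑ u, y' u :=
      Finset.sum_lt_sum (fun u _ => hle u) ⟨v, Finset.mem_univ _, by rw [hv']; exact hty⟩
    exact absurd (hmax hmem) (not_le.2 hlt)
  refine ⟨y, hzy, ?_, hyN, htight⟩
  intro v
  -- If a flat down-face has its apex at height `0`, then both ends of its upper edge, being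
  -- nonpositive, are at height `0` too. So the vertices at height `0` form a closed set.
  refine lt_of_le_of_ne (hy0 v) (hP.not_closed hneg hzA (Z := fun v => y v = 0) ?_ ?_ v)
  · intro v hv hN
    have := hyN v hN
    rw [hv] at this
    norm_num at this
  · intro i v k hA hv
    have h1 := htight i v k hA
    obtain ⟨-, w1, w2, -⟩ := hA
    rw [vol'_eq, hv] at h1
    have t1 := mul_nonpos_of_nonpos_of_nonneg (hy0 i) w2.le
    have t2 := mul_nonpos_of_nonpos_of_nonneg (hy0 k) w1.le
    exact ⟨(mul_eq_zero.1 (by linarith)).resolve_right w2.ne',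
      (mul_eq_zero.1 (by linarith)).resolve_right w1.ne'⟩

/-- The points are scaled to height `-1`. Exchanging the two horizontal coordinates absorbs the sign
of that third column. -/
theorem vol'_eq_planeArea {z : Fin n → ℝ} (hneg : ∀ v, z v < 0) (a b c : Fin n) :
    vol' p z a b c = (- z a) * (- z b) * (- z c) *
      planeArea (fun u => p u 1 / (- z u)) (fun u => p u 0 / (- z u)) a b c := by
  have ha := (hneg a).ne
  have hb := (hneg b).ne
  have hc := (hneg c).ne
  rw [vol'_eq]
  simp only [planeArea, wedge]
  field_simp
  ring

/-- Central projection to the plane below the south pole. -/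
theorem flatSystem (hP : PolarTriangulation G p) {y : Fin n → ℝ} (hneg : ∀ v, y v < 0)
    (hyN : ∀ v ∈ northVertices G p, y v = -1)
    (hflat : ∀ i v k, IsApex G p i v k → vol' p y i v k = 0) {n0 n1 n2 : Fin n}
    (hN : IsNorthFace G p n0 n1 n2) :
    FlatSystem (IsFace G p) (fun u => p u 1 / (- y u)) (fun u => p u 0 / (- y u)) n0 n1 n2 where
  faces := hP.faceSystem
  card := hP.card_triples
  inj u v h1 h2 := by
    by_contra hne
    apply hP.generic.wedge_ne_zero hne
    have hu := (hneg u).ne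
    have hv := (hneg v).ne
    have e1 : p u 1 * y v = p v 1 * y u := by
      field_simp at h1; linarith
    have e2 : p u 0 * y v = p v 0 * y u := by
      field_simp at h2; linarith
    have : y v * wedge (p u) (p v) = 0 := by
      unfold wedge; linear_combination p v 1 * e2 - p v 0 * e1
    exact (mul_eq_zero.1 this).resolve_left hv
  outer := hN.1
  outer_neg := by
    have h := vol'_eq_planeArea (p := p) hneg n0 n1 n2
    rw [vol'_eq, hyN n0 ⟨_, _, hN⟩, hyN n1 ⟨_, _, hN.rotate⟩, hyN n2 ⟨_, _, hN.rotate.rotate⟩] at h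
    have hw := (hP.northFace_iff hN.1).1 hN
    linarith [hw.1, hw.2.1, hw.2.2]
  flat v h0 h1 h2 := by
    have hv : v ∉ northVertices G p := by
      rw [hP.northVertices_eq hN]; simp [h0, h1, h2]
    obtain ⟨i, k, hA⟩ := hP.exists_apex hv
    have hz := hflat i v k hA
    obtain ⟨hf, w1, w2, w3⟩ := hA
    rw [vol'_eq] at hz
    have hi := (hneg i).ne
    have hk := (hneg k).ne
    have hv := (hneg v).ne
    -- The weights are those of the tight constraint, multiplied by the scaling factors of the
    -- projected points.
    refine ⟨k, i, hf.rotate, (- y i) * wedge (p v) (p k), (- y k) * wedge (p i) (p v),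
      mul_pos (by linarith [hneg i]) w2, mul_pos (by linarith [hneg k]) w1, ?_, ?_⟩
    · have e : y v * (p i 1 * wedge (p v) (p k) + p k 1 * wedge (p i) (p v))
          = p v 1 * (y i * wedge (p v) (p k) + y k * wedge (p i) (p v)) := by
        have : p i 1 * wedge (p v) (p k) + p k 1 * wedge (p i) (p v) =
          - (p v 1 * wedge (p k) (p i)) := by unfold wedge; ring
        linear_combination y v * this - p v 1 * hz
      field_simp
      linarith
    · have e : y v * (p i 0 * wedge (p v) (p k) + p k 0 * wedge (p i) (p v))
          = p v 0 * (y i * wedge (p v) (p k) + y k * wedge (p i) (p v)) := by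
        have : p i 0 * wedge (p v) (p k) + p k 0 * wedge (p i) (p v) =
          - (p v 0 * wedge (p k) (p i)) := by unfold wedge; ring
        linear_combination y v * this - p v 0 * hz
      field_simp
      linarith

/-- If all down-faces are flat, then the drawing is feasible. -/
theorem feasible_of_flat (hP : PolarTriangulation G p) {y : Fin n → ℝ} (hneg : ∀ v, y v < 0)
    (hyN : ∀ v ∈ northVertices G p, y v = -1)
    (hflat : ∀ i v k, IsApex G p i v k → vol' p y i v k = 0) : y ∈ sinkFeasible G p := by
  obtain ⟨n0, n1, n2, hN⟩ := hP.exists_northFace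
  refine ⟨hyN, fun a b c hf => ?_⟩
  -- A face on the three north vertices is either a rotation of the north face or its reversal,
  -- whose wedges are all negative, which makes it the south face.
  have hno : ¬ ((a = n0 ∨ a = n1 ∨ a = n2) ∧ (b = n0 ∨ b = n1 ∨ b = n2) ∧
      (c = n0 ∨ c = n1 ∨ c = n2)) := by
    obtain ⟨hF, hn, hs⟩ := hf
    rw [hP.northFace_iff hF] at hn
    rw [hP.southFace_iff hF] at hs
    have hw := (hP.northFace_iff hN.1).1 hN
    have w1 := wedge_swap (p n0) (p n1)
    have w2 := wedge_swap (p n1) (p n2)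
    have w3 := wedge_swap (p n2) (p n0)
    rintro ⟨rfl | rfl | rfl, rfl | rfl | rfl, rfl | rfl | rfl⟩ <;>
      first
      | exact hF.1.ne rfl
      | exact hF.2.1.ne rfl
      | exact hF.2.2.1.ne rfl
      | exact hn ⟨by linarith, by linarith, by linarith⟩
      | exact hs ⟨by linarith, by linarith, by linarith⟩
  have := (hP.flatSystem hneg hyN hflat hN).planeArea_nonneg hf.1 hno
  rw [vol'_eq_planeArea hneg]
  exact mul_nonneg (mul_nonneg (mul_nonneg (by linarith [hneg a]) (by linarith [hneg b]))
    (by linarith [hneg c])) this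

end PolarTriangulation
end

theorem mainTheorem1 (n : ℕ) (hn : 4 ≤ n) (G : SimpleGraph (Fin n)) (p : Fin n → Fin 3 → ℝ)
    (hT : IsGenericTriangulation G p)
    (hpoles : ∀ i j k, ¬ (IsNorthFace G p i j k ∧ IsSouthFace G p i j k))
    (z' : Fin n → ℝ) (hz : IsSinkOptimal G p z') :
    (northVertices G p).ncard + (downFaces G p).ncard = n ∧
      (∀ i ∈ northVertices G p, z' i = -1) ∧
      (∀ i j k, IsDownFace G p i j k → vol' p z' i j k = 0) := by
  have hP : PolarTriangulation G p := ⟨hn, hT, hpoles⟩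
  obtain ⟨hfeas, hmax⟩ := hz
  obtain ⟨y, hzy, hneg, hyN, hflat⟩ := hP.exists_flat hfeas
  have hle : ∑ i, y i ≤ ∑ i, z' i := hmax (hP.feasible_of_flat hneg hyN hflat)
  -- `y` is a feasible competitor that dominates `z'` coordinatewise, so equal sums force equal
  -- coordinates.
  have heq : z' = y := by
    have := (Finset.sum_eq_sum_iff_of_le fun i _ => hzy i).1
      (le_antisymm (Finset.sum_le_sum fun i _ => hzy i) hle)
    exact funext fun i => this i (Finset.mem_univ i)
  subst heq
  refine ⟨hP.ncard_downFaces, hfeas.1, fun i j k h => ?_⟩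
  rcases hP.exists_apex_of_downFace h with h | h | h
  · rw [← vol'_rotate, ← vol'_rotate]; exact hflat _ _ _ h
  · exact hflat _ _ _ h
  · rw [← vol'_rotate]; exact hflat _ _ _ h
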